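/- A graph is outerplanar if it can be drawn in the plane without crossings so that every vertex lies on the boundary of the unbounded face. For a finite graph $G$ with adjacency matrix $A$ and eigenvalues $\lambda_1\ge\cdots\ge\lambda_n$ of $A$, the spread of $G$ is $\lambda_1-\lambda_n$. A Perron eigenvector of $G$ is an eigenvector $\mathbf x$ of $A$ for $\lambda_1$ with nonnegative entries. A linear forest is a disjoint union of paths, and $G\vee H$ denotes the join of $G$ and $H$. Theorem. There is an integer $N$ such that for every $n\ge N$ the following holds for every $n$-vertex outerplanar graph $G$ whose spread is maximum among all $n$-vertex outerplanar graphs. The graph $G$ has a Perron eigenvector, and for every Perron eigenvector $\mathbf x$ of $G$ and every vertex $w$ at which $\mathbf x$ attains its maximum entry: 1. the degree of $w$ is $n-1$; 2. consequently $G = K_1\vee F$, where $K_1$ is the vertex $w$ and $F$ is a linear forest on the other $n-1$ vertices; 3. for every eigenvector $\mathbf z$ of $A$ for the eigenvalue $\lambda_n$, every vertex $w'$ with $|\mathbf z_{w'}|=\max_u|\mathbf z_u|$ is equal to $w$. -/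

import Mathlib

open Matrix

namespace OuterplanarSpread

/-- The Euclidean plane. -/
abbrev Plane : Type := EuclideanSpace ℝ (Fin 2)

/-- `A` is a simple (Jordan) arc with endpoints `p` and `q`: the image of an injective continuous
map from the unit interval which starts at `p` and ends at `q`. -/
def IsSimpleArc (A : Set Plane) (p q : Plane) : Prop :=
  ∃ γ : Path p q, Function.Injective γ ∧ Set.range γ = A

/-- A drawing of `G` in the plane without crossings: distinct vertices are distinct points, every
edge is a simple arc joining its two ends, an edge passes through no vertex other than its ends,
and two different edges meet at most in a common end.
(The values of `arc` on pairs that are not edges are irrelevant.) -/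
structure PlaneDrawing {V : Type*} (G : SimpleGraph V) where
  pos : V → Plane
  arc : Sym2 V → Set Plane
  pos_injective : Function.Injective pos
  isSimpleArc : ∀ u v : V, G.Adj u v → IsSimpleArc (arc s(u, v)) (pos u) (pos v)
  mem_of_pos_mem : ∀ e ∈ G.edgeSet, ∀ v : V, pos v ∈ arc e → v ∈ e
  inter_subset : ∀ e ∈ G.edgeSet, ∀ f ∈ G.edgeSet, e ≠ f →
    arc e ∩ arc f ⊆ pos '' {v | v ∈ e ∧ v ∈ f}

/-- The set of points of the plane that are used by the drawing. -/
def PlaneDrawing.carrier {V : Type*} {G : SimpleGraph V} (D : PlaneDrawing G) : Set Plane :=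
  Set.range D.pos ∪ ⋃ e ∈ G.edgeSet, D.arc e

/-- `F` is a face of the drawing: a connected component of the complement of the drawing. -/
def PlaneDrawing.IsFace {V : Type*} {G : SimpleGraph V} (D : PlaneDrawing G)
    (F : Set Plane) : Prop :=
  ∃ p ∈ D.carrierᶜ, F = connectedComponentIn D.carrierᶜ p

/-- A graph is outerplanar if it can be drawn in the plane without crossings in such a way that
all vertices are incident with (lie on the boundary of) the unbounded face. -/
def IsOuterplanar {V : Type*} (G : SimpleGraph V) : Prop :=
  ∃ D : PlaneDrawing G, ∃ F : Set Plane, D.IsFace F ∧ ¬ Bornology.IsBounded F ∧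
    ∀ v : V, D.pos v ∈ frontier F

open Classical in
/-- The adjacency matrix, with real entries. -/
noncomputable def adj {V : Type*} (G : SimpleGraph V) : Matrix V V ℝ :=
  G.adjMatrix ℝ

/-- The spread of a graph: the diameter of the spectrum of its adjacency matrix, that is, the
maximum of `|λᵢ - λⱼ|` over all pairs of eigenvalues. -/
noncomputable def spread {V : Type*} [Fintype V] [DecidableEq V] (G : SimpleGraph V) : ℝ :=
  Metric.diam (spectrum ℝ (adj G))

/-- `G` maximizes the spread over all outerplanar graphs on its vertex set. -/
def IsSpreadExtremal {V : Type*} [Fintype V] [DecidableEq V] (G : SimpleGraph V) : Prop :=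
  IsOuterplanar G ∧ ∀ H : SimpleGraph V, IsOuterplanar H → spread H ≤ spread G

/-- `x` is a Perron eigenvector of `G`: an eigenvector for the largest eigenvalue `λ₁` with
nonnegative entries. (For a connected graph its entries are then automatically positive.) -/
def IsPerronVector {V : Type*} [Fintype V] [DecidableEq V] (G : SimpleGraph V)
    (x : V → ℝ) : Prop :=
  ∃ μ : ℝ, IsGreatest (spectrum ℝ (adj G)) μ ∧ x ≠ 0 ∧ (∀ u, 0 ≤ x u) ∧ adj G *ᵥ x = μ • x

/-- `z` is an eigenvector of `G` for the smallest eigenvalue `λₙ`. -/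
def IsLeastEigenvector {V : Type*} [Fintype V] [DecidableEq V] (G : SimpleGraph V)
    (z : V → ℝ) : Prop :=
  ∃ μ : ℝ, IsLeast (spectrum ℝ (adj G)) μ ∧ z ≠ 0 ∧ adj G *ᵥ z = μ • z

/-- The join `G ∨ H`: the disjoint union of `G` and `H` together with all edges between them. -/
def join {V W : Type*} (G : SimpleGraph V) (H : SimpleGraph W) : SimpleGraph (V ⊕ W) :=
  SimpleGraph.sum G H ⊔ completeBipartiteGraph V W

/-- A linear forest is a disjoint union of paths: every connected component is a path. -/
def IsLinearForest {V : Type*} (F : SimpleGraph V) : Prop :=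
  ∀ c : F.ConnectedComponent, ∃ k : ℕ, Nonempty (c.toSimpleGraph ≃g SimpleGraph.pathGraph k)

end OuterplanarSpread

/-! ### Continuous logarithms and separation of the plane -/

namespace OuterplanarSpread

open Set Topology Filter

/-! Combinatorial input. In an outerplanar drawing every vertex is in the closure of one connected
region off the drawing. Three internally disjoint paths with common ends form a theta curve, and no
connected set off a theta curve accumulates at interior points of all three arcs (`theta_curve`,
proved by continuous logarithms). This excludes `K_{2,3}` minors of a suitable form
(`IsOuterplanar.not_minor`) and `K₄`. Hence two vertices have at most two common neighbours, the
degrees sum to at most `6n`, and the edges inside a neighbourhood form a linear forest. Conversely a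
cone over a linear forest is outerplanar, by drawing it with its vertices on a parabola.

Spectral argument. Put `r = √(n - 1)`. The star has spread `2r`, so an extremal graph has `λ₁ ≥ r`.
For an eigenvector with maximum modulus 1, applying the eigenvalue equation twice and counting
common neighbours gives `ν² ≤ deg + O(r)` at a vertex of maximum modulus. So `λ₁` and `-λₙ` are `r +
O(1)`, and the maximizers `w`, `w'` of both extreme eigenvectors have degree `n - O(r)`. Two such
vertices would have too many common neighbours, so `w = w'`; all other entries are `O(1/r)`.

If `w` had `b > 0` non-neighbours, replace `G` by the cone from `w` over the edges among its
neighbours, which is again outerplanar. Use each extreme eigenvector as a test vector, with entry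
`1/ν` put at the non-neighbours. The new edges at `w` change the quadratic form, relative to `ν`
times the squared norm, by `b/ν`, while the deleted edges matter only `O(b/r²)`
(`rayleigh_testVector`, `IsOuterplanar.abs_crossWeight_le`). Both Rayleigh quotients move outwards,
so the spread would increase strictly (`IsSpreadExtremal.eq_and_degree_eq`). -/

/-- `f` has a continuous logarithm on `K`. -/
def HasLog {X : Type*} [TopologicalSpace X] (f : X → ℂ) (K : Set X) : Prop :=
  ∃ h : X → ℂ, ContinuousOn h K ∧ ∀ x ∈ K, Complex.exp (h x) = f x

section HasLog

variable {X : Type*} [TopologicalSpace X] {f g : X → ℂ} {K L : Set X}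

theorem HasLog.mono (hf : HasLog f L) (hKL : K ⊆ L) : HasLog f K := by
  obtain ⟨h, hc, he⟩ := hf
  exact ⟨h, hc.mono hKL, fun x hx => he x (hKL hx)⟩

theorem HasLog.congr (hf : HasLog f K) (h : ∀ x ∈ K, f x = g x) : HasLog g K := by
  obtain ⟨l, hc, he⟩ := hf
  exact ⟨l, hc, fun x hx => (he x hx).trans (h x hx)⟩

theorem HasLog.mul (hf : HasLog f K) (hg : HasLog g K) : HasLog (fun x => f x * g x) K := by
  obtain ⟨l, hc, he⟩ := hf
  obtain ⟨m, hc', he'⟩ := hg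
  exact ⟨fun x => l x + m x, hc.add hc', fun x hx => by rw [Complex.exp_add, he x hx, he' x hx]⟩

theorem HasLog.inv (hf : HasLog f K) : HasLog (fun x => (f x)⁻¹) K := by
  obtain ⟨l, hc, he⟩ := hf
  exact ⟨fun x => -l x, hc.neg, fun x hx => by rw [Complex.exp_neg, he x hx]⟩

/-- The difference takes values in the discrete group `2πiℤ`, hence is constant on a preconnected
set. -/
theorem exists_const_of_exp_eq {h₁ h₂ : X → ℂ} (hK : IsPreconnected K) (h₁c : ContinuousOn h₁ K)
    (h₂c : ContinuousOn h₂ K) (he : ∀ x ∈ K, Complex.exp (h₁ x) = Complex.exp (h₂ x)) :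
    ∃ c : ℂ, Complex.exp c = 1 ∧ ∀ x ∈ K, h₁ x = h₂ x + c := by
  rcases K.eq_empty_or_nonempty with rfl | ⟨x₀, hx₀⟩
  · exact ⟨0, by simp, by simp⟩
  have hd : IsDiscrete (AddSubgroup.zmultiples (2 * Real.pi * Complex.I) : Set ℂ) :=
    ⟨NormedSpace.discreteTopology_zmultiples _⟩
  have hm : MapsTo (fun x => h₁ x - h₂ x) K
      (AddSubgroup.zmultiples (2 * Real.pi * Complex.I) : Set ℂ) := by
    intro x hx
    obtain ⟨n, hn⟩ := Complex.exp_eq_exp_iff_exists_int.1 (he x hx)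
    exact ⟨n, by simp [hn]⟩
  refine ⟨h₁ x₀ - h₂ x₀, ?_, fun x hx => ?_⟩
  · rw [Complex.exp_sub, he x₀ hx₀, div_self (Complex.exp_ne_zero _)]
  · have : h₁ x - h₂ x = h₁ x₀ - h₂ x₀ :=
      hK.constant_of_mapsTo hd (f := fun x => h₁ x - h₂ x) (h₁c.sub h₂c) hm hx hx₀
    rw [← this]; ring

/-- Shifting one logarithm by a constant makes the two agree on the overlap. Continuity is kept
separate on `K` and `L` so that closed pairs and open pairs can both be pasted. -/
theorem HasLog.glue_aux (hf : HasLog f K) (hf' : HasLog f L) (hKL : IsPreconnected (K ∩ L)) :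
    ∃ h : X → ℂ, ContinuousOn h K ∧ ContinuousOn h L ∧ ∀ x ∈ K ∪ L, Complex.exp (h x) = f x := by
  classical
  obtain ⟨h₁, h₁c, h₁e⟩ := hf
  obtain ⟨h₂, h₂c, h₂e⟩ := hf'
  obtain ⟨c, hc1, hc⟩ := exists_const_of_exp_eq hKL (h₁c.mono inter_subset_left)
    (h₂c.mono inter_subset_right) (fun x hx => (h₁e x hx.1).trans (h₂e x hx.2).symm)
  refine ⟨fun x => if x ∈ K then h₁ x else h₂ x + c, ?_, ?_, ?_⟩
  · exact h₁c.congr fun x hx => by simp [hx]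
  · refine (h₂c.add (continuousOn_const (c := c))).congr fun x hx => ?_
    by_cases hxK : x ∈ K
    · simp [hxK, hc x ⟨hxK, hx⟩]
    · simp [hxK]
  · intro x hx
    by_cases hxK : x ∈ K
    · simp [hxK, h₁e x hxK]
    · have hxL : x ∈ L := hx.resolve_left hxK
      simp [hxK, Complex.exp_add, hc1, h₂e x hxL]

theorem HasLog.union_of_isClosed (hf : HasLog f K) (hf' : HasLog f L)
    (hKL : IsPreconnected (K ∩ L)) (hK : IsClosed K) (hL : IsClosed L) : HasLog f (K ∪ L) := by
  obtain ⟨h, h1, h2, h3⟩ := hf.glue_aux hf' hKL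
  exact ⟨h, h1.union_of_isClosed h2 hK hL, h3⟩

theorem HasLog.union_of_isOpen (hf : HasLog f K) (hf' : HasLog f L)
    (hKL : IsPreconnected (K ∩ L)) (hK : IsOpen K) (hL : IsOpen L) : HasLog f (K ∪ L) := by
  obtain ⟨h, h1, h2, h3⟩ := hf.glue_aux hf' hKL
  exact ⟨h, h1.union_of_isOpen h2 hK hL, h3⟩

theorem hasLog_univ [SimplyConnectedSpace X] [LocallyPathConnectedSpace X] (hf : Continuous f)
    (h0 : ∀ x, f x ≠ 0) : HasLog f univ := by
  obtain ⟨x₀⟩ : Nonempty X := inferInstance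
  obtain ⟨F, ⟨-, hF⟩, -⟩ := Complex.isCoveringMapOn_exp.existsUnique_continuousMap_lifts
    (⟨f, hf⟩ : C(X, ℂ)) (a₀ := x₀) (Complex.exp_log (h0 x₀)) h0
  exact ⟨F, F.continuous.continuousOn, fun x _ => congr_fun hF x⟩

-- A homotopy from the constant 1 through nonvanishing functions lifts along the covering `exp`,
-- starting from the logarithm 0.
open unitInterval in
theorem hasLog_of_homotopy (F : I × K → ℂ) (hF : Continuous F) (h0 : ∀ a, F a ≠ 0)
    (hF0 : ∀ x, F (0, x) = 1) (hF1 : ∀ x : K, F (1, x) = f x) : HasLog f K := by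
  classical
  let H : C(I × K, {z : ℂ // z ≠ 0}) := ⟨fun a => ⟨F a, h0 a⟩, by fun_prop⟩
  let G := Complex.isCoveringMap_exp.liftHomotopy H (.const K 0)
    (fun a => Subtype.ext (by simp [H, hF0]))
  have hG : ∀ a, Complex.exp (G a) = F a := fun a => congr_arg Subtype.val
    (congr_fun (Complex.isCoveringMap_exp.liftHomotopy_lifts H (.const K 0)
      (fun a => Subtype.ext (by simp [H, hF0]))) a)
  refine ⟨fun x => if hx : x ∈ K then G (1, ⟨x, hx⟩) else 0, ?_, fun x hx => ?_⟩
  · rw [continuousOn_iff_continuous_domRestrict]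
    have : Continuous fun x : K => G (1, x) := by fun_prop
    convert this using 1
    ext x
    simp
  · simp [hx, hG, hF1]

end HasLog

/-- The quotient `(x - p) / (x - q)` has a continuous logarithm off a path from `q` to `p`. -/
theorem hasLog_div_of_path {p q : ℂ} {K : Set ℂ} (γ : Path q p) (hγ : ∀ t, γ t ∉ K) :
    HasLog (fun x => (x - p) / (x - q)) K := by
  have hne : ∀ t (x : K), (x : ℂ) - γ t ≠ 0 := fun t x h => hγ t (by
    rw [← sub_eq_zero.1 h]; exact x.2)
  have hq : ∀ x : K, (x : ℂ) - q ≠ 0 := fun x => by simpa using hne 0 x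
  refine hasLog_of_homotopy (fun a => ((a.2 : ℂ) - γ a.1) / (a.2 - q)) ?_ ?_ ?_ ?_
  · exact Continuous.div (by fun_prop) (by fun_prop) fun a => hq a.2
  · exact fun a => div_ne_zero (hne _ _) (hq _)
  · intro x; simp [div_self (hq x)]
  · intro x; simp

theorem hasLog_div_of_joinedIn {p q : ℂ} {K : Set ℂ} (h : JoinedIn Kᶜ p q) :
    HasLog (fun x => (x - p) / (x - q)) K := by
  obtain ⟨γ, hγ⟩ := h.symm
  exact hasLog_div_of_path γ hγ

/-- Along the circle a logarithm would be `t * I + log r` up to a constant, which is not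
`2π`-periodic. -/
theorem not_hasLog_sphere (p : ℂ) {r : ℝ} (hr : 0 < r) :
    ¬ HasLog (fun x => x - p) (Metric.sphere p r) := by
  rintro ⟨h, hc, he⟩
  have hmem : ∀ t : ℝ, circleMap p r t ∈ Metric.sphere p r := fun t =>
    circleMap_mem_sphere p hr.le t
  have hlog : Complex.exp (Real.log r) = r := by
    rw [← Complex.ofReal_exp, Real.exp_log hr]
  obtain ⟨c, -, hcc⟩ := exists_const_of_exp_eq (K := (univ : Set ℝ))
    (h₁ := fun t => h (circleMap p r t)) (h₂ := fun t => t * Complex.I + Real.log r)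
    isPreconnected_univ
    (hc.comp (continuous_circleMap p r).continuousOn fun t _ => hmem t)
    (by fun_prop) (fun t _ => by
      rw [he _ (hmem t), Complex.exp_add, hlog]
      simp [circleMap, mul_comm])
  have h0 := hcc 0 trivial
  have h1 := hcc (2 * Real.pi) trivial
  have hper : circleMap p r (2 * Real.pi) = circleMap p r 0 := by
    simpa using (periodic_circleMap p r) 0
  rw [hper, h0] at h1
  have : (2 * Real.pi : ℂ) * Complex.I = 0 := by
    push_cast at h1
    linear_combination -h1
  simp [Real.pi_ne_zero] at this

/-- Both components leave a large disc, whose exterior is path connected as the exponential image of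
a half-plane. Taking `max R 1` keeps the radius positive. -/
theorem joinedIn_compl_of_not_isBounded {K : Set ℂ} (hK : IsCompact K) {p q : ℂ}
    (hp : ¬ Bornology.IsBounded (pathComponentIn Kᶜ p))
    (hq : ¬ Bornology.IsBounded (pathComponentIn Kᶜ q)) : JoinedIn Kᶜ p q := by
  obtain ⟨R, hR⟩ := hK.isBounded.subset_closedBall 0
  have hfar : ∀ {C : Set ℂ}, ¬ Bornology.IsBounded C → ∃ x ∈ C, max R 1 < ‖x‖ := by
    intro C hC
    by_contra! hcon
    exact hC ((Metric.isBounded_closedBall (x := (0 : ℂ)) (r := max R 1)).subset fun x hx => by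
      simpa using hcon x hx)
  obtain ⟨x, hx, hxR⟩ := hfar hp
  obtain ⟨y, hy, hyR⟩ := hfar hq
  have hout : IsPathConnected {z : ℂ | max R 1 < ‖z‖} := by
    have h1 : IsPathConnected {z : ℂ | Real.log (max R 1) < z.re} :=
      (convex_halfSpace_re_gt _).isPathConnected ⟨(Real.log (max R 1) + 1 : ℝ), by simp⟩
    have h2 := h1.image Complex.continuous_exp
    convert h2 using 1
    ext z
    have hpos : 0 < max R 1 := by positivity
    constructor
    · intro hz
      have hz0 : z ≠ 0 := by
        rintro rfl
        simp at hz
        linarith [hz.2]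
      refine ⟨Complex.log z, ?_, Complex.exp_log hz0⟩
      rw [mem_ofPred_eq, Complex.log_re]
      exact Real.log_lt_log hpos hz
    · rintro ⟨w, hw, rfl⟩
      rw [mem_ofPred_eq, Complex.norm_exp]
      exact (Real.log_lt_iff_lt_exp hpos).1 hw
  have hsub : {z : ℂ | max R 1 < ‖z‖} ⊆ Kᶜ := by
    intro z hz hzK
    have := hR hzK
    simp at this
    exact absurd hz (by simp [this])
  have hxy : JoinedIn Kᶜ x y := (hout.joinedIn x hxR y hyR).mono hsub
  exact (show JoinedIn Kᶜ p x from hx).trans (hxy.trans (show JoinedIn Kᶜ q y from hy).symm)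

theorem frontier_pathComponentIn_subset {U : Set ℂ} (hU : IsOpen U) (p : ℂ) :
    frontier (pathComponentIn U p) ⊆ Uᶜ := by
  intro x hx hxU
  have ho : IsOpen (pathComponentIn U x) := hU.pathComponentIn x
  have hx' : x ∈ pathComponentIn U x := JoinedIn.refl hxU
  obtain ⟨y, hyx, hyp⟩ := mem_closure_iff.1 hx.1 _ ho hx'
  have : x ∈ pathComponentIn U p :=
    (show JoinedIn U p y from hyp).trans (show JoinedIn U x y from hyx).symm
  have ho' : IsOpen (pathComponentIn U p) := hU.pathComponentIn p
  exact hx.2 (by rwa [ho'.interior_eq])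

/-- If `q` were outside the bounded component `C` of `p`, extend the logarithm from `K` to `H` on
the plane (Tietze). The function equal to `(x - q) * exp (H x)` on `C` and to `x - p` elsewhere is
continuous because the boundary of `C` lies in `K`. It has no zero, so it has a logarithm on the
whole plane; but on a large circle it is `x - p`, which has none. -/
theorem joinedIn_compl_of_hasLog_aux {K : Set ℂ} (hK : IsCompact K) {p q : ℂ} (hp : p ∉ K)
    (hq : q ∉ K) (hlog : HasLog (fun x => (x - p) / (x - q)) K)
    (hb : Bornology.IsBounded (pathComponentIn Kᶜ p)) : JoinedIn Kᶜ p q := by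
  classical
  by_contra hcon
  obtain ⟨h, hc, he⟩ := hlog
  obtain ⟨H, hH⟩ := ContinuousMap.exists_restrict_eq hK.isClosed
    (⟨K.domRestrict h, continuousOn_iff_continuous_domRestrict.1 hc⟩ : C(K, ℂ))
  have hHK : ∀ x ∈ K, H x = h x := fun x hx => by
    have := congr($hH ⟨x, hx⟩)
    simpa using this
  set C := pathComponentIn Kᶜ p with hC
  have hCo : IsOpen C := hK.isClosed.isOpen_compl.pathComponentIn p
  have hpC : p ∈ C := JoinedIn.refl hp
  have hqC : q ∉ C := hcon
  have hfr : frontier C ⊆ K := by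
    simpa using frontier_pathComponentIn_subset hK.isClosed.isOpen_compl p
  let φ : ℂ → ℂ := fun x => if x ∈ C then (x - q) * Complex.exp (H x) else x - p
  have hφc : Continuous φ := by
    refine continuous_if (fun a ha => ?_) (by fun_prop) (by fun_prop)
    have haK : a ∈ K := hfr ha
    have haq : a - q ≠ 0 := sub_ne_zero.2 fun h => hq (h ▸ haK)
    rw [hHK a haK, he a haK]
    field_simp
  have hφ0 : ∀ x, φ x ≠ 0 := by
    intro x
    by_cases hx : x ∈ C
    · simp only [φ, hx, if_true]
      exact mul_ne_zero (sub_ne_zero.2 fun h => hqC (h ▸ hx)) (Complex.exp_ne_zero _)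
    · simp only [φ, hx, if_false]
      exact sub_ne_zero.2 fun h => hx (h ▸ hpC)
  obtain ⟨R, hR0, hR⟩ := hb.subset_ball_lt 0 p
  refine not_hasLog_sphere p hR0 (((hasLog_univ hφc hφ0).mono (subset_univ _)).congr ?_)
  intro x hx
  have : x ∉ C := fun hxC => by
    have := Metric.mem_ball.1 (hR hxC)
    rw [Metric.mem_sphere.1 hx] at this
    exact lt_irrefl _ this
  simp [φ, this]

/-- A compact set on which `(x - p) / (x - q)` has a continuous logarithm does not separate `p`
from `q`. -/
theorem joinedIn_compl_of_hasLog {K : Set ℂ} (hK : IsCompact K) {p q : ℂ} (hp : p ∉ K)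
    (hq : q ∉ K) (hlog : HasLog (fun x => (x - p) / (x - q)) K) : JoinedIn Kᶜ p q := by
  by_cases hb : Bornology.IsBounded (pathComponentIn Kᶜ p)
  · exact joinedIn_compl_of_hasLog_aux hK hp hq hlog hb
  by_cases hb' : Bornology.IsBounded (pathComponentIn Kᶜ q)
  · exact (joinedIn_compl_of_hasLog_aux hK hq hp (hlog.inv.congr fun x _ => by simp) hb').symm
  exact joinedIn_compl_of_not_isBounded hK hb hb'

theorem hasLog_range_path {P Q : ℂ} (γ : Path P Q) (hγ : Function.Injective γ) {f : ℂ → ℂ}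
    (hf : ContinuousOn f (range γ)) (h0 : ∀ x ∈ range γ, f x ≠ 0) : HasLog f (range γ) := by
  obtain ⟨l, hl, hle⟩ := hasLog_univ (X := ℝ) (f := fun t => f (γ.extend t))
    (hf.comp_continuous γ.continuous_extend fun t => by
      rw [← γ.extend_range]; exact mem_range_self t)
    (fun t => h0 _ (by rw [← γ.extend_range]; exact mem_range_self t))
  have hemb : IsClosedEmbedding γ := γ.continuous.isClosedEmbedding hγ
  let e := hemb.isEmbedding.toHomeomorph
  classical
  refine ⟨fun x => if hx : x ∈ range γ then l (e.symm ⟨x, hx⟩) else 0, ?_, fun x hx => ?_⟩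
  · rw [continuousOn_iff_continuous_domRestrict]
    have : Continuous fun x : range γ => l (e.symm x) := by
      have := continuousOn_univ.1 hl
      fun_prop
    convert this using 1
    ext x
    simp only [domRestrict_apply, x.2, dif_pos]
  · obtain ⟨t, rfl⟩ := hx
    have : e.symm ⟨γ t, mem_range_self t⟩ = t := by
      rw [Homeomorph.symm_apply_eq]; rfl
    simp only [mem_range_self, dif_pos, this]
    simpa [γ.extend_apply t.2] using hle t trivial

end OuterplanarSpread

/-! ### Simple closed curves and theta curves -/

namespace OuterplanarSpread

open Set Topology Filter

theorem inter_frontier_nonempty_of_isPreconnected {X : Type*} [TopologicalSpace X] {S V : Set X}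
    (hS : IsPreconnected S) (hV : IsOpen V) (h1 : (S ∩ V).Nonempty) (h2 : (S \ V).Nonempty) :
    (S ∩ frontier V).Nonempty := by
  by_contra hcon
  rw [not_nonempty_iff_eq_empty] at hcon
  have hout : ∀ x ∈ S, x ∉ V → x ∈ (closure V)ᶜ := fun x hx hxV hxc => by
    have : x ∈ S ∩ frontier V := ⟨hx, hxc, by rwa [hV.interior_eq]⟩
    rwa [hcon] at this
  obtain ⟨y, hy, hyV⟩ := h2
  obtain ⟨z, -, hz1, hz2⟩ := hS V (closure V)ᶜ hV isClosed_closure.isOpen_compl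
    (fun x hx => (em (x ∈ V)).imp_right (hout x hx)) h1 ⟨y, hy, hout y hy hyV⟩
  exact hz2 (subset_closure hz1)

theorem sub_div_sub_ne_zero {K : Set ℂ} {p q : ℂ} (hp : p ∉ K) (hq : q ∉ K) :
    ∀ x ∈ K, (x - p) / (x - q) ≠ 0 := fun _ hx =>
  div_ne_zero (sub_ne_zero.2 fun h => hp (h ▸ hx)) (sub_ne_zero.2 fun h => hq (h ▸ hx))

theorem continuousOn_sub_div_sub {K : Set ℂ} {p q : ℂ} (hq : q ∉ K) :
    ContinuousOn (fun x : ℂ => (x - p) / (x - q)) K :=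
  ContinuousOn.div (by fun_prop) (by fun_prop) fun x hx => sub_ne_zero.2 fun h => hq (h ▸ hx)

theorem hasLog_arc {P Q : ℂ} (γ : Path P Q) (hγ : Function.Injective γ) {p q : ℂ}
    (hp : p ∉ range γ) (hq : q ∉ range γ) : HasLog (fun x => (x - p) / (x - q)) (range γ) :=
  hasLog_range_path γ hγ (continuousOn_sub_div_sub hq) (sub_div_sub_ne_zero hp hq)

/-- On a small circle about `P` the factor `x - Q` has a logarithm, so `x - P` would have one too.
-/
theorem not_hasLog_compl_pair {P Q : ℂ} (h : P ≠ Q) :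
    ¬ HasLog (fun x => (x - P) / (x - Q)) ({P, Q} : Set ℂ)ᶜ := by
  intro hl
  have hd : 0 < dist P Q := dist_pos.2 h
  set r := dist P Q / 2 with hr
  have hr0 : 0 < r := by positivity
  have hPQ : P - Q ≠ 0 := sub_ne_zero.2 h
  have hlt : ∀ x ∈ Metric.sphere P r, ‖(x - P) / (P - Q)‖ < 1 := by
    intro x hx
    rw [norm_div, ← dist_eq_norm, ← dist_eq_norm, Metric.mem_sphere.1 hx, div_lt_one hd]
    linarith
  have hrw : ∀ x, (x - Q) / (P - Q) = 1 + (x - P) / (P - Q) := by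
    intro x; field_simp; ring
  have hslit : ∀ x ∈ Metric.sphere P r, (x - Q) / (P - Q) ∈ Complex.slitPlane := by
    intro x hx
    left
    rw [hrw]
    have := (abs_le.1 (Complex.abs_re_le_norm ((x - P) / (P - Q)))).1
    have := hlt x hx
    simp only [Complex.add_re, Complex.one_re]
    linarith
  have hsub : Metric.sphere P r ⊆ ({P, Q} : Set ℂ)ᶜ := by
    rintro x hx (rfl | rfl)
    · simp at hx; linarith
    · rw [Metric.mem_sphere, dist_comm] at hx; linarith
  have h2 : HasLog (fun x => x - Q) (Metric.sphere P r) := by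
    refine ⟨fun x => Complex.log ((x - Q) / (P - Q)) + Complex.log (P - Q), ?_, fun x hx => ?_⟩
    · exact (ContinuousOn.clog (by fun_prop) hslit).add continuousOn_const
    · rw [Complex.exp_add, Complex.exp_log (Complex.slitPlane_ne_zero (hslit x hx)),
        Complex.exp_log hPQ]
      field_simp
  refine not_hasLog_sphere P hr0 (((hl.mono hsub).mul h2).congr fun x hx => ?_)
  have : x - Q ≠ 0 := sub_ne_zero.2 fun h => hsub hx (by simp [h])
  field_simp

section Arcs

variable {P Q : ℂ}

/-- The complement of a simple closed curve is not connected. -/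
theorem not_isPreconnected_compl_union {γ₁ γ₂ : Path P Q} (hPQ : P ≠ Q)
    (h12 : range γ₁ ∩ range γ₂ ⊆ {P, Q}) :
    ¬ IsPreconnected (range γ₁ ∪ range γ₂)ᶜ := by
  intro hc
  -- Each arc joins `P` to `Q`, so the quotient has a logarithm off either arc. Connectedness of the
  -- intersection of the two complements would allow gluing to a logarithm off `{P, Q}`.
  have hlog : ∀ γ : Path P Q, HasLog (fun x => (x - P) / (x - Q)) (range γ)ᶜ := fun γ =>
    hasLog_div_of_path γ.symm fun t ht => ht (by rw [← γ.symm_range]; exact mem_range_self t)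
  have hcl : ∀ γ : Path P Q, IsOpen (range γ)ᶜ := fun γ =>
    (isCompact_range γ.continuous).isClosed.isOpen_compl
  rw [compl_union] at hc
  refine not_hasLog_compl_pair hPQ
    (((hlog γ₁).union_of_isOpen (hlog γ₂) hc (hcl _) (hcl _)).mono ?_)
  rw [← compl_inter]
  exact compl_subset_compl.2 h12

theorem exists_not_joinedIn_compl_union {γ₁ γ₂ : Path P Q} (hPQ : P ≠ Q)
    (h12 : range γ₁ ∩ range γ₂ ⊆ {P, Q}) (u : ℂ) :
    ∃ v ∈ (range γ₁ ∪ range γ₂)ᶜ, ¬ JoinedIn (range γ₁ ∪ range γ₂)ᶜ u v := by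
  by_contra! hcon
  refine not_isPreconnected_compl_union hPQ h12 ?_
  rcases (range γ₁ ∪ range γ₂)ᶜ.eq_empty_or_nonempty with he | ⟨v, hv⟩
  · rw [he]; exact isPreconnected_empty
  · have hpc : IsPathConnected (range γ₁ ∪ range γ₂)ᶜ :=
      ⟨v, hv, fun {y} hy => (hcon v hv).symm.trans (hcon y hy)⟩
    exact hpc.isConnected.isPreconnected

open unitInterval in
/-- Each complementary component of a simple closed curve accumulates at each of its points. -/
theorem mem_closure_pathComponentIn {γ₁ γ₂ : Path P Q} (hγ₁ : Function.Injective γ₁)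
    (hγ₂ : Function.Injective γ₂) (h12 : range γ₁ ∩ range γ₂ ⊆ {P, Q})
    {u v : ℂ} (hu : u ∉ range γ₁ ∪ range γ₂) (hv : v ∉ range γ₁ ∪ range γ₂)
    (huv : ¬ JoinedIn (range γ₁ ∪ range γ₂)ᶜ u v) {a : ℂ} (ha : a ∈ range γ₁) (haP : a ≠ P)
    (haQ : a ≠ Q) : a ∈ closure (pathComponentIn (range γ₁ ∪ range γ₂)ᶜ v) := by
  by_contra hcon
  set J := range γ₁ ∪ range γ₂ with hJ
  set V := pathComponentIn Jᶜ v with hV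
  obtain ⟨t, rfl⟩ := ha
  have hc1 : IsCompact (range γ₁) := isCompact_range γ₁.continuous
  have hc2 : IsCompact (range γ₂) := isCompact_range γ₂.continuous
  have hJc : IsCompact J := hc1.union hc2
  have hVo : IsOpen V := hJc.isClosed.isOpen_compl.pathComponentIn v
  have hopen : IsOpen (γ₁ ⁻¹' (closure V)ᶜ) := isClosed_closure.isOpen_compl.preimage γ₁.continuous
  obtain ⟨ε, hε, hball⟩ := Metric.isOpen_iff.1 hopen t hcon
  have hlog : HasLog (fun x => (x - u) / (x - v)) (range γ₁) :=
    hasLog_arc γ₁ hγ₁ (fun h => hu (Or.inl h)) (fun h => hv (Or.inl h))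
  have hlog2 : HasLog (fun x => (x - u) / (x - v)) (range γ₂) :=
    hasLog_arc γ₂ hγ₂ (fun h => hu (Or.inr h)) (fun h => hv (Or.inr h))
  -- Remove from `γ₁` a piece around `t` that stays away from the closure of `V`. What remains of
  -- the curve is glued from arcs meeting in at most one point, so it carries a logarithm and does
  -- not separate `u` from `v`.
  let L₁ : Set I := {s | (s : ℝ) ≤ t - ε}
  let L₂ : Set I := {s | (t : ℝ) + ε ≤ s}
  have hL₁ : IsClosed L₁ := isClosed_le (by fun_prop) (by fun_prop)
  have hL₂ : IsClosed L₂ := isClosed_le (by fun_prop) (by fun_prop)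
  have hi1 : IsCompact (γ₁ '' L₁) := hL₁.isCompact.image γ₁.continuous
  have hi2 : IsCompact (γ₁ '' L₂) := hL₂.isCompact.image γ₁.continuous
  have hzero : ∀ s, γ₁ s = P → s = 0 := fun s hs => hγ₁ (hs.trans γ₁.source.symm)
  have hone : ∀ s, γ₁ s = Q → s = 1 := fun s hs => hγ₁ (hs.trans γ₁.target.symm)
  have hK1 : HasLog (fun x => (x - u) / (x - v)) (γ₁ '' L₁ ∪ range γ₂) := by
    refine (hlog.mono (image_subset_range _ _)).union_of_isClosed hlog2 ?_ hi1.isClosed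
      hc2.isClosed
    refine Set.Subsingleton.isPreconnected (Set.subsingleton_of_forall_eq P ?_)
    rintro x ⟨⟨s, hs, rfl⟩, hx⟩
    rcases h12 ⟨mem_range_self s, hx⟩ with h | h
    · exact h
    · exfalso
      have := hone s h
      subst this
      have h1 : (1 : ℝ) ≤ t - ε := hs
      linarith [t.2.2]
  have hK2 : HasLog (fun x => (x - u) / (x - v)) ((γ₁ '' L₁ ∪ range γ₂) ∪ γ₁ '' L₂) := by
    refine hK1.union_of_isClosed (hlog.mono (image_subset_range _ _)) ?_
      (hi1.isClosed.union hc2.isClosed) hi2.isClosed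
    refine Set.Subsingleton.isPreconnected (Set.subsingleton_of_forall_eq Q ?_)
    rintro x ⟨hx, ⟨s, hs, rfl⟩⟩
    have hs' : (t : ℝ) + ε ≤ s := hs
    rcases hx with ⟨s', hs'', hss⟩ | hx
    · exfalso
      obtain rfl := hγ₁ hss
      have : (s' : ℝ) ≤ t - ε := hs''
      linarith
    · rcases h12 ⟨mem_range_self s, hx⟩ with h | h
      · exfalso
        have := hzero s h
        subst this
        have h0 : (t : ℝ) + ε ≤ 0 := hs
        linarith [t.2.1]
      · exact h
  set K := (γ₁ '' L₁ ∪ range γ₂) ∪ γ₁ '' L₂ with hK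
  have hKJ : K ⊆ J := by
    rintro x ((⟨s, -, rfl⟩ | hx) | ⟨s, -, rfl⟩)
    · exact Or.inl (mem_range_self s)
    · exact Or.inr hx
    · exact Or.inl (mem_range_self s)
  have hjoin : JoinedIn Kᶜ u v := joinedIn_compl_of_hasLog ((hi1.union hc2).union hi2)
    (fun h => hu (hKJ h)) (fun h => hv (hKJ h)) hK2
  -- The boundary of `V` avoids the removed piece, so a path from `v` to `u` off `K` can never leave
  -- `V`.
  have hfr : frontier V ⊆ K := by
    intro x hx
    have hxJ : x ∈ J := by
      simpa using frontier_pathComponentIn_subset hJc.isClosed.isOpen_compl v hx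
    rcases hxJ with ⟨s, rfl⟩ | hx2
    · have hns : s ∉ Metric.ball t ε := fun h => hball h hx.1
      rw [Metric.mem_ball, Subtype.dist_eq, Real.dist_eq, not_lt, le_abs] at hns
      rcases hns with h | h
      · exact Or.inr ⟨s, show (t : ℝ) + ε ≤ s by linarith, rfl⟩
      · exact Or.inl (Or.inl ⟨s, show (s : ℝ) ≤ t - ε by linarith, rfl⟩)
    · exact Or.inl (Or.inr hx2)
  obtain ⟨δ, hδ⟩ := hjoin.symm
  have hpre : IsPreconnected (range δ) := isPreconnected_range δ.continuous
  have hvV : v ∈ V := JoinedIn.refl hv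
  have huV : u ∉ V := fun h => huv (show JoinedIn Jᶜ v u from h).symm
  obtain ⟨x, hx, hxf⟩ := inter_frontier_nonempty_of_isPreconnected hpre hVo
    ⟨v, ⟨0, δ.source⟩, hvV⟩ ⟨u, ⟨1, δ.target⟩, huV⟩
  obtain ⟨s, rfl⟩ := hx
  exact hδ s (hfr hxf)

open unitInterval in
theorem joinedIn_of_arc {γ : Path P Q} (hγ : Function.Injective γ) {S : Set ℂ}
    (hS : range γ ∩ S ⊆ {P, Q}) {a b : ℂ} (ha : a ∈ range γ) (hb : b ∈ range γ)
    (ha' : a ≠ P ∧ a ≠ Q) (hb' : b ≠ P ∧ b ≠ Q) : JoinedIn Sᶜ a b := by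
  obtain ⟨s, rfl⟩ := ha
  obtain ⟨t, rfl⟩ := hb
  have hpc : IsPathConnected (Set.Ioo (0 : ℝ) 1) :=
    (convex_Ioo 0 1).isPathConnected ⟨1 / 2, by norm_num, by norm_num⟩
  have hio : ∀ s : I, γ s ≠ P ∧ γ s ≠ Q → (s : ℝ) ∈ Set.Ioo (0 : ℝ) 1 := by
    rintro s ⟨h0, h1⟩
    refine ⟨lt_of_le_of_ne s.2.1 fun h => h0 ?_, lt_of_le_of_ne s.2.2 fun h => h1 ?_⟩
    · exact (congr_arg γ (Subtype.ext h.symm)).trans γ.source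
    · exact (congr_arg γ (Subtype.ext h)).trans γ.target
  have h := (hpc.joinedIn _ (hio s ha') _ (hio t hb')).map_continuousOn
    (f := γ.extend) γ.continuous_extend.continuousOn
  rw [γ.extend_apply s.2, γ.extend_apply t.2] at h
  refine h.mono ?_
  rintro x ⟨y, hy, rfl⟩ hxS
  have hyI : y ∈ I := ⟨hy.1.le, hy.2.le⟩
  rw [γ.extend_apply hyI] at hxS
  rcases hS ⟨mem_range_self _, hxS⟩ with h | h
  · have := congr_arg Subtype.val (hγ (h.trans γ.source.symm))
    simp at this; exact hy.1.ne' this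
  · have := congr_arg Subtype.val (hγ (h.trans γ.target.symm))
    simp at this; exact hy.2.ne this

/-- A small disc about `a` bridges the two sets. -/
theorem joinedIn_of_mem_closure {S A B : Set ℂ} (hS : IsClosed S) {a u v : ℂ} (ha : a ∉ S)
    (hA : a ∈ closure A) (hB : a ∈ closure B) (hAu : ∀ y ∈ A, JoinedIn Sᶜ u y)
    (hBv : ∀ y ∈ B, JoinedIn Sᶜ v y) : JoinedIn Sᶜ u v := by
  obtain ⟨ε, hε, hball⟩ := Metric.isOpen_iff.1 hS.isOpen_compl a ha
  obtain ⟨y, hy, hyA⟩ := mem_closure_iff.1 hA _ Metric.isOpen_ball (Metric.mem_ball_self hε)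
  obtain ⟨z, hz, hzB⟩ := mem_closure_iff.1 hB _ Metric.isOpen_ball (Metric.mem_ball_self hε)
  have hyz : JoinedIn Sᶜ y z :=
    (((convex_ball a ε).isPathConnected ⟨a, Metric.mem_ball_self hε⟩).joinedIn y hy z hz).mono hball
  exact (hAu y hyA).trans (hyz.trans (hBv z hzB).symm)

/-- No connected set off a theta curve accumulates at interior points of all its three arcs. -/
theorem theta_curve {γ₁ γ₂ γ₃ : Path P Q} (hPQ : P ≠ Q) (hγ₁ : Function.Injective γ₁)
    (hγ₂ : Function.Injective γ₂) (hγ₃ : Function.Injective γ₃)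
    (h12 : range γ₁ ∩ range γ₂ ⊆ {P, Q}) (h13 : range γ₁ ∩ range γ₃ ⊆ {P, Q})
    (h23 : range γ₂ ∩ range γ₃ ⊆ {P, Q}) {U : Set ℂ} (hU : IsPreconnected U)
    (hUd : U ⊆ (range γ₁ ∪ range γ₂ ∪ range γ₃)ᶜ) {a₁ a₂ a₃ : ℂ} (h1 : a₁ ∈ range γ₁)
    (h2 : a₂ ∈ range γ₂) (h3 : a₃ ∈ range γ₃) (h1' : a₁ ≠ P ∧ a₁ ≠ Q) (h2' : a₂ ≠ P ∧ a₂ ≠ Q)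
    (h3' : a₃ ≠ P ∧ a₃ ≠ Q) (hc1 : a₁ ∈ closure U) (hc2 : a₂ ∈ closure U)
    (hc3 : a₃ ∈ closure U) : False := by
  have hk1 : IsCompact (range γ₁) := isCompact_range γ₁.continuous
  have hk2 : IsCompact (range γ₂) := isCompact_range γ₂.continuous
  have hk3 : IsCompact (range γ₃) := isCompact_range γ₃.continuous
  set θ := range γ₁ ∪ range γ₂ ∪ range γ₃ with hθ
  set J := range γ₁ ∪ range γ₂ with hJ
  have hθo : IsOpen θᶜ := ((hk1.union hk2).union hk3).isClosed.isOpen_compl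
  have hJθ : J ⊆ θ := subset_union_left
  obtain ⟨u, hu⟩ : U.Nonempty := closure_nonempty_iff.1 ⟨a₁, hc1⟩
  have hUj : ∀ y ∈ U, JoinedIn θᶜ u y := by
    intro y hy
    have hcc : IsConnected (connectedComponentIn θᶜ u) :=
      isConnected_connectedComponentIn_iff.2 (hUd hu)
    have := hθo.connectedComponentIn.isConnected_iff_isPathConnected.1 hcc
    exact (this.joinedIn u (mem_connectedComponentIn (hUd hu)) y
      (hU.subset_connectedComponentIn hu hUd hy)).mono (connectedComponentIn_subset _ _)
  -- Choose `v` on the other side of the closed curve `J`. The aim is to join `u` to `v` off the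
  -- whole theta curve.
  obtain ⟨v, hvJ, huv⟩ := exists_not_joinedIn_compl_union hPQ h12 u
  rw [← hJ] at huv
  have huJ : u ∉ J := fun h => hUd hu (hJθ h)
  have hPJ : P ∈ J := Or.inl ⟨0, γ₁.source⟩
  have hQJ : Q ∈ J := Or.inl ⟨1, γ₁.target⟩
  have hJ3 : range γ₃ ∩ J ⊆ {P, Q} := by
    rintro x ⟨hx3, hx | hx⟩
    · exact h13 ⟨hx, hx3⟩
    · exact h23 ⟨hx, hx3⟩
  have hmono : Jᶜ ⊇ θᶜ := compl_subset_compl.2 hJθ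
  -- Since `U` accumulates at `a₃`, the whole interior of `γ₃` lies on the side of `u`. The other
  -- side `V` therefore misses the theta curve.
  have hu3 : ∀ y ∈ range γ₃, y ∉ J → JoinedIn Jᶜ u y := by
    intro y hy hyJ
    refine joinedIn_of_mem_closure (A := U) (B := range γ₃ \ {P, Q}) (a := a₃)
      (hk1.union hk2).isClosed ?_ hc3 (subset_closure ⟨h3, by simpa using h3'⟩)
      (fun z hz => (hUj z hz).mono hmono) (fun z hz => ?_)
    · intro h
      rcases hJ3 ⟨h3, h⟩ with h | h
      exacts [h3'.1 h, h3'.2 h]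
    · refine joinedIn_of_arc hγ₃ hJ3 hy hz.1 ⟨?_, ?_⟩ (by simpa using hz.2)
      · rintro rfl; exact hyJ hPJ
      · rintro rfl; exact hyJ hQJ
  set V := pathComponentIn Jᶜ v with hV
  have hVJ : V ⊆ Jᶜ := pathComponentIn_subset
  have hVθ : V ⊆ θᶜ := by
    rintro y hy (hyJ | hy3)
    · exact hVJ hy hyJ
    · exact huv ((hu3 y hy3 (hVJ hy)).trans (show JoinedIn Jᶜ v y from hy).symm)
  have hvV : v ∈ V := JoinedIn.refl hvJ
  have hVj : ∀ y ∈ V, JoinedIn θᶜ v y := fun y hy =>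
    ((isPathConnected_pathComponentIn (show v ∈ Jᶜ from hvJ)).joinedIn v hvV y hy).mono hVθ
  have hcl1 : a₁ ∈ closure V := mem_closure_pathComponentIn hγ₁ hγ₂ h12 huJ hvJ huv h1 h1'.1 h1'.2
  have hcl2 : a₂ ∈ closure V := by
    have hcomm : range γ₁ ∪ range γ₂ = range γ₂ ∪ range γ₁ := union_comm _ _
    rw [hV, hJ, hcomm]
    rw [hJ, hcomm] at huv huJ
    rw [hcomm] at hvJ
    exact mem_closure_pathComponentIn hγ₂ hγ₁ (by rwa [inter_comm]) huJ hvJ huv h2 h2'.1 h2'.2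
  -- `U` and `V` both accumulate at `a₂`, so one can pass from one to the other through the interior
  -- of `γ₂`; for `hj23` the passage is at `a₁`.
  have hj13 : JoinedIn (range γ₁ ∪ range γ₃)ᶜ u v := by
    have hsub : θᶜ ⊆ (range γ₁ ∪ range γ₃)ᶜ := compl_subset_compl.2
      (union_subset_union_left _ subset_union_left)
    refine joinedIn_of_mem_closure (hk1.union hk3).isClosed ?_ hc2 hcl2
      (fun y hy => (hUj y hy).mono hsub) (fun y hy => (hVj y hy).mono hsub)
    rintro (h | h)
    · rcases h12 ⟨h, h2⟩ with h | h
      exacts [h2'.1 h, h2'.2 h]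
    · rcases h23 ⟨h2, h⟩ with h | h
      exacts [h2'.1 h, h2'.2 h]
  have hj23 : JoinedIn (range γ₂ ∪ range γ₃)ᶜ u v := by
    have hsub : θᶜ ⊆ (range γ₂ ∪ range γ₃)ᶜ := compl_subset_compl.2
      (union_subset_union_left _ subset_union_right)
    refine joinedIn_of_mem_closure (hk2.union hk3).isClosed ?_ hc1 hcl1
      (fun y hy => (hUj y hy).mono hsub) (fun y hy => (hVj y hy).mono hsub)
    rintro (h | h)
    · rcases h12 ⟨h1, h⟩ with h | h
      exacts [h1'.1 h, h1'.2 h]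
    · rcases h13 ⟨h1, h⟩ with h | h
      exacts [h1'.1 h, h1'.2 h]
  have hinter : (range γ₁ ∪ range γ₃) ∩ (range γ₂ ∪ range γ₃) = range γ₃ := by
    rw [← inter_union_distrib_right, union_eq_right]
    intro x hx
    rcases h12 hx with h | h
    · exact ⟨0, γ₃.source.trans h.symm⟩
    · exact ⟨1, γ₃.target.trans h.symm⟩
  -- The two partial curves meet exactly in `γ₃`, which is connected, so their logarithms glue and
  -- the full theta curve does not separate `u` from `v` (Janiszewski's argument).
  have hlog : HasLog (fun x => (x - u) / (x - v)) θ := by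
    have := (hasLog_div_of_joinedIn hj13).union_of_isClosed (hasLog_div_of_joinedIn hj23)
      (by rw [hinter]; exact isPreconnected_range γ₃.continuous) (hk1.union hk3).isClosed
      (hk2.union hk3).isClosed
    refine this.mono ?_
    rintro x ((hx | hx) | hx)
    · exact Or.inl (Or.inl hx)
    · exact Or.inr (Or.inl hx)
    · exact Or.inl (Or.inr hx)
  exact huv ((joinedIn_compl_of_hasLog ((hk1.union hk2).union hk3) (hUd hu) (hVθ hvV)
    hlog).mono hmono)

end Arcs

end OuterplanarSpread

/-! ### Paths of a drawn graph as arcs in the plane -/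

namespace OuterplanarSpread

open Set Topology Filter

theorem IsSimpleArc.trans {A B : Set Plane} {p q r : Plane} (hA : IsSimpleArc A p q)
    (hB : IsSimpleArc B q r) (hAB : A ∩ B ⊆ {q}) : IsSimpleArc (A ∪ B) p r := by
  obtain ⟨γ, hγ, rfl⟩ := hA
  obtain ⟨δ, hδ, rfl⟩ := hB
  refine ⟨γ.trans δ, ?_, Path.trans_range γ δ⟩
  have key : ∀ s t : unitInterval, (s : ℝ) ≤ 1 / 2 → ¬ (t : ℝ) ≤ 1 / 2 →
      γ.trans δ s ≠ γ.trans δ t := by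
    intro s t hs ht h
    rw [Path.trans_apply, Path.trans_apply, dif_pos hs, dif_neg ht] at h
    have hq := hAB ⟨⟨_, h⟩, mem_range_self _⟩
    have h1 := congr_arg Subtype.val (hδ (Eq.trans hq δ.source.symm))
    simp at h1
    exact ht (by linarith)
  intro s t h
  by_cases hs : (s : ℝ) ≤ 1 / 2 <;> by_cases ht : (t : ℝ) ≤ 1 / 2
  · rw [Path.trans_apply, Path.trans_apply, dif_pos hs, dif_pos ht] at h
    have := congr_arg Subtype.val (hγ h)
    exact Subtype.ext (by simpa using this)
  · exact absurd h (key s t hs ht)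
  · exact absurd h.symm (key t s ht hs)
  · rw [Path.trans_apply, Path.trans_apply, dif_neg hs, dif_neg ht] at h
    have := congr_arg Subtype.val (hδ h)
    exact Subtype.ext (by simpa using this)

/-- `theta_curve`, in the Euclidean plane. -/
theorem theta_curve_plane {P Q : Plane} {A₁ A₂ A₃ : Set Plane} (hPQ : P ≠ Q)
    (hA₁ : IsSimpleArc A₁ P Q) (hA₂ : IsSimpleArc A₂ P Q) (hA₃ : IsSimpleArc A₃ P Q)
    (h12 : A₁ ∩ A₂ ⊆ {P, Q}) (h13 : A₁ ∩ A₃ ⊆ {P, Q}) (h23 : A₂ ∩ A₃ ⊆ {P, Q}) {U : Set Plane}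
    (hU : IsPreconnected U) (hUd : U ⊆ (A₁ ∪ A₂ ∪ A₃)ᶜ) {a₁ a₂ a₃ : Plane} (h1 : a₁ ∈ A₁)
    (h2 : a₂ ∈ A₂) (h3 : a₃ ∈ A₃) (h1' : a₁ ≠ P ∧ a₁ ≠ Q) (h2' : a₂ ≠ P ∧ a₂ ≠ Q)
    (h3' : a₃ ≠ P ∧ a₃ ≠ Q) (hc1 : a₁ ∈ closure U) (hc2 : a₂ ∈ closure U)
    (hc3 : a₃ ∈ closure U) : False := by
  let e : Plane ≃ₜ ℂ := Complex.orthonormalBasisOneI.repr.symm.toHomeomorph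
  obtain ⟨γ₁, hγ₁, rfl⟩ := hA₁
  obtain ⟨γ₂, hγ₂, rfl⟩ := hA₂
  obtain ⟨γ₃, hγ₃, rfl⟩ := hA₃
  have hr : ∀ γ : Path P Q, range (γ.map e.continuous) = e '' range γ := fun γ => by
    rw [← range_comp]; rfl
  have hi : ∀ γ : Path P Q, Function.Injective γ → Function.Injective (γ.map e.continuous) :=
    fun γ h => e.injective.comp h
  have hpair : ({e P, e Q} : Set ℂ) = e '' {P, Q} := (image_pair e P Q).symm
  have hcl : ∀ x, x ∈ closure U → e x ∈ closure (e '' U) := fun x hx => by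
    rw [← e.image_closure]; exact mem_image_of_mem e hx
  have hne : ∀ x, x ≠ P ∧ x ≠ Q → e x ≠ e P ∧ e x ≠ e Q := fun x hx =>
    ⟨e.injective.ne hx.1, e.injective.ne hx.2⟩
  refine theta_curve (γ₁ := γ₁.map e.continuous) (γ₂ := γ₂.map e.continuous)
    (γ₃ := γ₃.map e.continuous) (e.injective.ne hPQ) (hi _ hγ₁) (hi _ hγ₂) (hi _ hγ₃)
    ?_ ?_ ?_ (hU.image e e.continuous.continuousOn) ?_ (a₁ := e a₁) (a₂ := e a₂) (a₃ := e a₃)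
    (by rw [hr]; exact mem_image_of_mem e h1) (by rw [hr]; exact mem_image_of_mem e h2)
    (by rw [hr]; exact mem_image_of_mem e h3) (hne _ h1') (hne _ h2') (hne _ h3')
    (hcl _ hc1) (hcl _ hc2) (hcl _ hc3)
  · rw [hr, hr, hpair, ← image_inter e.injective]; exact image_mono h12
  · rw [hr, hr, hpair, ← image_inter e.injective]; exact image_mono h13
  · rw [hr, hr, hpair, ← image_inter e.injective]; exact image_mono h23
  · rw [hr, hr, hr, ← image_union, ← image_union, ← image_compl_eq e.bijective]
    exact image_mono hUd

namespace PlaneDrawing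

variable {V : Type*} {G : SimpleGraph V} (D : PlaneDrawing G)

/-- The points of the plane on the arcs of the edges of a walk. -/
def trace {u v : V} (p : G.Walk u v) : Set Plane := ⋃ e ∈ p.edges, D.arc e

theorem trace_subset_carrier {u v : V} (p : G.Walk u v) : D.trace p ⊆ D.carrier := by
  intro x hx
  simp only [trace, mem_iUnion] at hx
  obtain ⟨e, he, hx⟩ := hx
  exact Or.inr (mem_biUnion (p.edges_subset_edgeSet he) hx)

theorem pos_left_mem_arc {u v : V} (h : G.Adj u v) : D.pos u ∈ D.arc s(u, v) := by
  obtain ⟨γ, -, hr⟩ := D.isSimpleArc u v h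
  rw [← hr]; exact ⟨0, γ.source⟩

theorem pos_mem_arc {e : Sym2 V} (he : e ∈ G.edgeSet) {x : V} (hx : x ∈ e) :
    D.pos x ∈ D.arc e := by
  obtain ⟨y, rfl⟩ := hx
  exact D.pos_left_mem_arc he

theorem pos_mem_trace {u v x : V} (p : G.Walk u v) (huv : u ≠ v) (hx : x ∈ p.support) :
    D.pos x ∈ D.trace p := by
  obtain ⟨e, he, hxe⟩ := (SimpleGraph.Walk.mem_support_iff_exists_mem_edges_of_not_nil
    (SimpleGraph.Walk.not_nil_of_ne huv)).1 hx
  simp only [trace, mem_iUnion]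
  exact ⟨e, he, D.pos_mem_arc (p.edges_subset_edgeSet he) hxe⟩

theorem isSimpleArc_trace {u v : V} (p : G.Walk u v) (hp : p.IsPath) (huv : u ≠ v) :
    IsSimpleArc (D.trace p) (D.pos u) (D.pos v) := by
  induction p with
  | nil => exact absurd rfl huv
  | @cons a b c h p ih =>
    rw [SimpleGraph.Walk.cons_isPath_iff] at hp
    have htr : D.trace (p.cons h) = D.arc s(a, b) ∪ D.trace p := by
      ext x; simp [trace]
    by_cases hbc : b = c
    · subst hbc
      rw [SimpleGraph.Walk.isPath_iff_nil, ← SimpleGraph.Walk.eq_nil_iff_nil] at hp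
      obtain ⟨rfl, -⟩ := hp
      rw [htr]
      simpa [trace] using D.isSimpleArc a b h
    · rw [htr]
      refine (D.isSimpleArc a b h).trans (ih hp.1 hbc) ?_
      rintro x ⟨hx1, hx2⟩
      simp only [trace, mem_iUnion] at hx2
      obtain ⟨f, hf, hx2⟩ := hx2
      have hne : s(a, b) ≠ f := by
        rintro rfl
        exact hp.2 (p.fst_mem_support_of_mem_edges hf)
      obtain ⟨z, ⟨hz1, hz2⟩, rfl⟩ := D.inter_subset _ h _ (p.edges_subset_edgeSet hf) hne ⟨hx1, hx2⟩
      rcases Sym2.mem_iff.1 hz1 with rfl | rfl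
      · exact absurd (p.mem_support_of_mem_edges hf hz2) hp.2
      · rfl

/-- Disjointness of edges is a separate condition because both walks could be the single edge from
`c` to `m`. -/
theorem trace_inter_trace {c m : V} {p q : G.Walk c m}
    (hpq : ∀ x ∈ p.support, x ∈ q.support → x = c ∨ x = m)
    (he : ∀ e ∈ p.edges, e ∉ q.edges) : D.trace p ∩ D.trace q ⊆ {D.pos c, D.pos m} := by
  rintro x ⟨hx1, hx2⟩
  simp only [trace, mem_iUnion] at hx1 hx2
  obtain ⟨e, he1, hx1⟩ := hx1
  obtain ⟨f, hf1, hx2⟩ := hx2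
  have hne : e ≠ f := by rintro rfl; exact he _ he1 hf1
  obtain ⟨z, ⟨hz1, hz2⟩, rfl⟩ := D.inter_subset _ (p.edges_subset_edgeSet he1) _
    (q.edges_subset_edgeSet hf1) hne ⟨hx1, hx2⟩
  rcases hpq z (p.mem_support_of_mem_edges he1 hz1) (q.mem_support_of_mem_edges hf1 hz2) with h | h
  · exact Or.inl (congr_arg D.pos h)
  · exact Or.inr (congr_arg D.pos h)

/-- A connected set off three internally disjoint paths with common ends does not accumulate at
interior points of all three. -/
theorem not_three_paths {c m : V} (hcm : c ≠ m) {p q r : G.Walk c m} (hp : p.IsPath)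
    (hq : q.IsPath) (hr : r.IsPath)
    (hpq : ∀ x ∈ p.support, x ∈ q.support → x = c ∨ x = m)
    (hpr : ∀ x ∈ p.support, x ∈ r.support → x = c ∨ x = m)
    (hqr : ∀ x ∈ q.support, x ∈ r.support → x = c ∨ x = m)
    (hpq' : ∀ e ∈ p.edges, e ∉ q.edges) (hpr' : ∀ e ∈ p.edges, e ∉ r.edges)
    (hqr' : ∀ e ∈ q.edges, e ∉ r.edges) {U : Set Plane} (hU : IsPreconnected U)
    (hUd : U ⊆ (D.trace p ∪ D.trace q ∪ D.trace r)ᶜ) {a₁ a₂ a₃ : Plane}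
    (h1 : a₁ ∈ D.trace p) (h2 : a₂ ∈ D.trace q) (h3 : a₃ ∈ D.trace r)
    (h1' : a₁ ≠ D.pos c ∧ a₁ ≠ D.pos m) (h2' : a₂ ≠ D.pos c ∧ a₂ ≠ D.pos m)
    (h3' : a₃ ≠ D.pos c ∧ a₃ ≠ D.pos m)
    (hc1 : a₁ ∈ closure U) (hc2 : a₂ ∈ closure U) (hc3 : a₃ ∈ closure U) : False :=
  theta_curve_plane (D.pos_injective.ne hcm) (D.isSimpleArc_trace p hp hcm)
    (D.isSimpleArc_trace q hq hcm) (D.isSimpleArc_trace r hr hcm) (D.trace_inter_trace hpq hpq')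
    (D.trace_inter_trace hpr hpr') (D.trace_inter_trace hqr hqr') hU hUd h1 h2 h3 h1' h2' h3'
    hc1 hc2 hc3

end PlaneDrawing

theorem IsOuterplanar.exists_region {V : Type*} {G : SimpleGraph V} (h : IsOuterplanar G) :
    ∃ (D : PlaneDrawing G) (U : Set Plane), IsPreconnected U ∧ U ⊆ D.carrierᶜ ∧
      ∀ v, D.pos v ∈ closure U := by
  obtain ⟨D, F, ⟨p, -, rfl⟩, -, hF⟩ := h
  exact ⟨D, _, isPreconnected_connectedComponentIn, connectedComponentIn_subset _ _,
    fun v => (hF v).1⟩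

end OuterplanarSpread

/-! ### Forbidden minors of outerplanar graphs -/

namespace OuterplanarSpread

open Set Topology Filter

section Minors

variable {V : Type*} {G : SimpleGraph V}

/-- A common edge would have both ends in `{c, m}`. -/
theorem edges_disjoint_of_support {c m : V} {p q : G.Walk c m}
    (hpq : ∀ x ∈ p.support, x ∈ q.support → x = c ∨ x = m) (h : s(c, m) ∉ p.edges) :
    ∀ e ∈ p.edges, e ∉ q.edges := by
  intro e hp hq
  induction e using Sym2.ind with
  | _ a b =>
    have hab : a ≠ b := (p.adj_of_mem_edges hp).ne
    have ha := hpq a (p.fst_mem_support_of_mem_edges hp) (q.fst_mem_support_of_mem_edges hq)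
    have hb := hpq b (p.snd_mem_support_of_mem_edges hp) (q.snd_mem_support_of_mem_edges hq)
    rcases ha with rfl | rfl <;> rcases hb with rfl | rfl
    · exact hab rfl
    · exact h hp
    · exact h (Sym2.eq_swap ▸ hp)
    · exact hab rfl

/-- A leg leaves `c` through `y` and then stays in `S` up to `m`. Three legs form the theta curve
used below. -/
theorem leg_isPath {c y x m : V} {S : Set V} (hcy : G.Adj c y) (hyx : G.Adj y x)
    {T : G.Walk x m} (hT : T.IsPath) (hTS : ∀ z ∈ T.support, z ∈ S) (hc : c ∉ S) (hy : y ∉ S) :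
    (SimpleGraph.Walk.cons hcy (.cons hyx T)).IsPath := by
  simp only [SimpleGraph.Walk.cons_isPath_iff, SimpleGraph.Walk.support_cons, List.mem_cons, not_or]
  exact ⟨⟨hT, fun h => hy (hTS _ h)⟩, hcy.ne, fun h => hc (hTS _ h)⟩

theorem leg_edges {c y x m : V} {S : Set V} (hcy : G.Adj c y) (hyx : G.Adj y x)
    {T : G.Walk x m} (hTS : ∀ z ∈ T.support, z ∈ S) (hc : c ∉ S) (hy : y ∉ S) :
    s(c, m) ∉ (SimpleGraph.Walk.cons hcy (.cons hyx T)).edges := by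
  have hm : m ∈ S := hTS _ T.end_mem_support
  simp only [SimpleGraph.Walk.edges_cons, List.mem_cons, not_or]
  refine ⟨fun h => ?_, fun h => ?_, fun h => hc (hTS _ (T.fst_mem_support_of_mem_edges h))⟩
  · rcases Sym2.eq_iff.1 h with ⟨-, rfl⟩ | ⟨rfl, -⟩
    · exact hy hm
    · exact hcy.ne rfl
  · rcases Sym2.eq_iff.1 h with ⟨rfl, -⟩ | ⟨rfl, -⟩
    · exact hcy.ne rfl
    · exact hc (hTS _ T.start_mem_support)

theorem legs_inter {c y y' x x' m : V} {S : Set V} (hcy : G.Adj c y) (hyx : G.Adj y x)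
    (hcy' : G.Adj c y') (hyx' : G.Adj y' x') {T : G.Walk x m} {T' : G.Walk x' m}
    (hTS : ∀ z ∈ T.support, z ∈ S) (hTS' : ∀ z ∈ T'.support, z ∈ S) (hy : y ∉ S) (hy' : y' ∉ S)
    (hyy : y ≠ y') (hTT : ∀ z ∈ T.support, z ∈ T'.support → z = m) :
    ∀ z ∈ (SimpleGraph.Walk.cons hcy (.cons hyx T)).support,
      z ∈ (SimpleGraph.Walk.cons hcy' (.cons hyx' T')).support → z = c ∨ z = m := by
  intro z hz hz'
  simp only [SimpleGraph.Walk.support_cons, List.mem_cons] at hz hz'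
  rcases hz with rfl | rfl | hz
  · exact Or.inl rfl
  · rcases hz' with h | h | h
    · exact Or.inl h
    · exact absurd h hyy
    · exact absurd (hTS' _ h) hy
  · rcases hz' with h | rfl | h
    · exact Or.inl h
    · exact absurd (hTS _ hz) hy'
    · exact Or.inr (hTT z hz h)

theorem IsOuterplanar.not_three_legs (h : IsOuterplanar G) {c m y₁ y₂ y₃ x₁ x₂ x₃ : V} {S : Set V}
    (hc : c ∉ S) (hy₁ : y₁ ∉ S) (hy₂ : y₂ ∉ S) (hy₃ : y₃ ∉ S) (h12 : y₁ ≠ y₂) (h13 : y₁ ≠ y₃)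
    (h23 : y₂ ≠ y₃) (hc1 : G.Adj c y₁) (hc2 : G.Adj c y₂) (hc3 : G.Adj c y₃)
    (hx1 : G.Adj y₁ x₁) (hx2 : G.Adj y₂ x₂) (hx3 : G.Adj y₃ x₃)
    {T₁ : G.Walk x₁ m} {T₂ : G.Walk x₂ m} {T₃ : G.Walk x₃ m} (hT₁ : T₁.IsPath) (hT₂ : T₂.IsPath)
    (hT₃ : T₃.IsPath) (hS₁ : ∀ z ∈ T₁.support, z ∈ S) (hS₂ : ∀ z ∈ T₂.support, z ∈ S)
    (hS₃ : ∀ z ∈ T₃.support, z ∈ S) (hT12 : ∀ z ∈ T₁.support, z ∈ T₂.support → z = m)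
    (hT13 : ∀ z ∈ T₁.support, z ∈ T₃.support → z = m)
    (hT23 : ∀ z ∈ T₂.support, z ∈ T₃.support → z = m) : False := by
  obtain ⟨D, U, hU, hUd, hcl⟩ := h.exists_region
  have hm : m ∈ S := hS₁ _ T₁.end_mem_support
  have hcm : c ≠ m := fun h => hc (h ▸ hm)
  have i12 := legs_inter hc1 hx1 hc2 hx2 hS₁ hS₂ hy₁ hy₂ h12 hT12
  have i13 := legs_inter hc1 hx1 hc3 hx3 hS₁ hS₃ hy₁ hy₃ h13 hT13
  have i23 := legs_inter hc2 hx2 hc3 hx3 hS₂ hS₃ hy₂ hy₃ h23 hT23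
  have e1 := leg_edges hc1 hx1 hS₁ hc hy₁
  have e2 := leg_edges hc2 hx2 hS₂ hc hy₂
  have hne : ∀ {y : V}, G.Adj c y → y ∉ S → D.pos y ≠ D.pos c ∧ D.pos y ≠ D.pos m :=
    fun hcy hy => ⟨D.pos_injective.ne hcy.ne', D.pos_injective.ne fun h => hy (h ▸ hm)⟩
  -- The `yᵢ` are interior points of the three arcs, and all of them lie in the closure of the outer
  -- region.
  refine D.not_three_paths hcm (leg_isPath hc1 hx1 hT₁ hS₁ hc hy₁)
    (leg_isPath hc2 hx2 hT₂ hS₂ hc hy₂) (leg_isPath hc3 hx3 hT₃ hS₃ hc hy₃) i12 i13 i23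
    (edges_disjoint_of_support i12 e1) (edges_disjoint_of_support i13 e1)
    (edges_disjoint_of_support i23 e2) hU (hUd.trans (compl_subset_compl.2 ?_))
    (a₁ := D.pos y₁) (a₂ := D.pos y₂) (a₃ := D.pos y₃)
    (D.pos_mem_trace _ hcm (by simp)) (D.pos_mem_trace _ hcm (by simp))
    (D.pos_mem_trace _ hcm (by simp)) (hne hc1 hy₁) (hne hc2 hy₂) (hne hc3 hy₃)
    (hcl _) (hcl _) (hcl _)
  exact union_subset (union_subset (D.trace_subset_carrier _) (D.trace_subset_carrier _))
    (D.trace_subset_carrier _)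

theorem exists_walk_of_walk_induce {S : Set V} {a b : S} (p : (G.induce S).Walk a b) :
    ∃ q : G.Walk a b, ∀ z ∈ q.support, z ∈ S := by
  induction p with
  | @nil a => exact ⟨.nil, by simp⟩
  | @cons a b c h p ih =>
    obtain ⟨q, hq⟩ := ih
    refine ⟨.cons (SimpleGraph.induce_adj.1 h) q, fun z hz => ?_⟩
    rcases List.mem_cons.1 hz with rfl | hz
    · exact a.2
    · exact hq z hz

theorem exists_path_of_preconnected_induce {S : Set V} (hS : (G.induce S).Preconnected) {a b : V}
    (ha : a ∈ S) (hb : b ∈ S) : ∃ p : G.Walk a b, p.IsPath ∧ ∀ z ∈ p.support, z ∈ S := by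
  classical
  obtain ⟨p⟩ := hS ⟨a, ha⟩ ⟨b, hb⟩
  obtain ⟨q, hq⟩ := exists_walk_of_walk_induce p
  exact ⟨q.bypass, q.bypass_isPath, fun z hz => hq z (q.support_bypass_subset_support hz)⟩

/-- An outerplanar graph has no `K_{2,3}` minor in which four branch sets are singletons. -/
theorem IsOuterplanar.not_minor (h : IsOuterplanar G) {c y₁ y₂ y₃ x₁ x₂ x₃ : V} {S : Set V}
    (hS : (G.induce S).Preconnected) (hc : c ∉ S) (hy₁ : y₁ ∉ S) (hy₂ : y₂ ∉ S) (hy₃ : y₃ ∉ S)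
    (h12 : y₁ ≠ y₂) (h13 : y₁ ≠ y₃) (h23 : y₂ ≠ y₃) (hc1 : G.Adj c y₁) (hc2 : G.Adj c y₂)
    (hc3 : G.Adj c y₃) (hx1 : G.Adj y₁ x₁) (hx2 : G.Adj y₂ x₂) (hx3 : G.Adj y₃ x₃)
    (hS₁ : x₁ ∈ S) (hS₂ : x₂ ∈ S) (hS₃ : x₃ ∈ S) : False := by
  classical
  obtain ⟨Q, hQ, hQS⟩ := exists_path_of_preconnected_induce hS hS₁ hS₂
  -- The branch vertex `m` is the end of a shortest path inside `S` from `x₃` to the path `Q`;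
  -- minimality makes it meet `Q` only in `m`.
  have hex : ∃ n : ℕ, ∃ m ∈ Q.support, ∃ R : G.Walk x₃ m, R.IsPath ∧
      (∀ z ∈ R.support, z ∈ S) ∧ R.length = n := by
    obtain ⟨R, hR, hRS⟩ := exists_path_of_preconnected_induce hS hS₃ hS₁
    exact ⟨_, x₁, Q.start_mem_support, R, hR, hRS, rfl⟩
  obtain ⟨m, hm, R, hR, hRS, hRn⟩ := Nat.find_spec hex
  have hRQ : ∀ z ∈ R.support, z ∈ Q.support → z = m := by
    intro z hz hzQ
    by_contra hne
    have hlt := R.length_takeUntil_lt_length hz hne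
    rw [hRn] at hlt
    exact Nat.find_min hex hlt ⟨z, hzQ, R.takeUntil z hz, hR.takeUntil hz,
      fun w hw => hRS w (R.support_takeUntil_subset_support hz hw), rfl⟩
  have hsplit : ∀ z ∈ (Q.takeUntil m hm).support, z ∈ (Q.dropUntil m hm).support → z = m := by
    intro z hz1 hz2
    have hnd := hQ.support_nodup
    rw [← Q.take_spec hm, SimpleGraph.Walk.support_append] at hnd
    rcases (SimpleGraph.Walk.mem_support_iff _).1 hz2 with h | h
    · exact h
    · exact absurd h ((List.disjoint_of_nodup_append hnd) hz1)
  have hsub1 := Q.support_takeUntil_subset_support hm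
  have hsub2 := Q.support_dropUntil_subset_support hm
  refine h.not_three_legs hc hy₁ hy₂ hy₃ h12 h13 h23 hc1 hc2 hc3 hx1 hx2 hx3
    (hQ.takeUntil hm) (hQ.dropUntil hm).reverse hR
    (fun z hz => hQS z (hsub1 hz)) (fun z hz => hQS z (hsub2 (by simpa using hz))) hRS
    (fun z h1 h2 => hsplit z h1 (by simpa using h2)) (fun z h1 h2 => hRQ z h2 (hsub1 h1))
    (fun z h1 h2 => hRQ z h2 (hsub2 (by simpa using h1)))

theorem IsOuterplanar.not_k23 (h : IsOuterplanar G) {c m y₁ y₂ y₃ : V} (hcm : c ≠ m)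
    (h12 : y₁ ≠ y₂) (h13 : y₁ ≠ y₃) (h23 : y₂ ≠ y₃) (hc1 : G.Adj c y₁) (hc2 : G.Adj c y₂)
    (hc3 : G.Adj c y₃) (hm1 : G.Adj m y₁) (hm2 : G.Adj m y₂) (hm3 : G.Adj m y₃) : False :=
  h.not_minor (S := {m}) (x₁ := m) (x₂ := m) (x₃ := m)
    (SimpleGraph.Preconnected.of_subsingleton) hcm hm1.ne' hm2.ne' hm3.ne' h12 h13 h23
    hc1 hc2 hc3 hm1.symm hm2.symm hm3.symm rfl rfl rfl

/-- An outerplanar graph contains no `K₄`. -/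
theorem IsOuterplanar.not_k4 (h : IsOuterplanar G) {f : Fin 4 → V}
    (hf : ∀ i j, i ≠ j → G.Adj (f i) (f j)) : False := by
  obtain ⟨D, U, hU, hUd, hcl⟩ := h.exists_region
  have hinj : Function.Injective f := fun i j hij => by
    by_contra hne
    exact (hf i j hne).ne hij
  set K : Set Plane := ⋃ i, ⋃ j, ⋃ _ : i ≠ j, D.arc s(f i, f j) with hK
  have harcK : ∀ i j, i ≠ j → D.arc s(f i, f j) ⊆ K := fun i j hij x hx => by
    simp only [hK, mem_iUnion]; exact ⟨i, j, hij, hx⟩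
  have hKcar : K ⊆ D.carrier := by
    intro x hx
    simp only [hK, mem_iUnion] at hx
    obtain ⟨i, j, hij, hx⟩ := hx
    exact Or.inr (mem_biUnion (hf i j hij) hx)
  have hKc : IsClosed K := by
    refine isClosed_iUnion_of_finite fun i => isClosed_iUnion_of_finite fun j =>
      isClosed_iUnion_of_finite fun hij => ?_
    obtain ⟨γ, -, hr⟩ := D.isSimpleArc _ _ (hf i j hij)
    rw [← hr]
    exact (isCompact_range γ.continuous).isClosed
  obtain ⟨u, hu⟩ : U.Nonempty := closure_nonempty_iff.1 ⟨_, hcl (f 0)⟩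
  have hUK : U ⊆ Kᶜ := hUd.trans (compl_subset_compl.2 hKcar)
  set C := connectedComponentIn Kᶜ u with hC
  have hCo : IsOpen C := hKc.isOpen_compl.connectedComponentIn
  have hUC : U ⊆ C := hU.subset_connectedComponentIn hu hUK
  have hCK : C ⊆ Kᶜ := connectedComponentIn_subset _ _
  have hCp : IsPreconnected C := isPreconnected_connectedComponentIn
  have hclC : ∀ v, D.pos v ∈ closure C := fun v => closure_mono hUC (hcl v)
  have hposK : ∀ i, D.pos (f i) ∈ K := fun i => by
    obtain ⟨j, hj⟩ : ∃ j, i ≠ j := ⟨i + 1, by fin_cases i <;> decide⟩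
    exact harcK i j hj (D.pos_left_mem_arc (hf i j hj))
  -- A point of `closure C` inside the edge `ij` would form a forbidden triple with the vertices `k`
  -- and `l`: the edge and the paths through `k` and `l` make a theta curve.
  have hmiss : ∀ i j, i ≠ j → ∀ z ∈ D.arc s(f i, f j), z ∈ closure C →
      z = D.pos (f i) ∨ z = D.pos (f j) := by
    intro i j hij z hz hzC
    by_contra! hcon
    have hthird : ∀ i j : Fin 4, ∃ k l, i ≠ k ∧ k ≠ j ∧ i ≠ l ∧ l ≠ j ∧ k ≠ l := by decide
    obtain ⟨k, l, hki, hkj, hli, hlj, hkl⟩ := hthird i j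
    have hcm : f i ≠ f j := hinj.ne hij
    have n1 := hinj.ne hki
    have n2 := hinj.ne hkj
    have n3 := hinj.ne hli
    have n4 := hinj.ne hlj
    have n5 := hinj.ne hkl
    refine D.not_three_paths hcm (p := .cons (hf i j hij) .nil)
      (q := .cons (hf i k hki) (.cons (hf k j hkj) .nil))
      (r := .cons (hf i l hli) (.cons (hf l j hlj) .nil))
      ?_ ?_ ?_ ?_ ?_ ?_ ?_ ?_ ?_ hCp ?_ (a₁ := z) (a₂ := D.pos (f k)) (a₃ := D.pos (f l))
      ?_ ?_ ?_ hcon ⟨D.pos_injective.ne n1.symm, D.pos_injective.ne n2⟩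
      ⟨D.pos_injective.ne n3.symm, D.pos_injective.ne n4⟩ hzC (hclC _) (hclC _)
    · simp [hcm]
    · simp [hcm, n1, n2]
    · simp [hcm, n3, n4]
    · simp
    · simp
    · rintro x hx hx'
      simp only [SimpleGraph.Walk.support_cons, SimpleGraph.Walk.support_nil, List.mem_cons,
        List.not_mem_nil, or_false] at hx hx'
      rcases hx with rfl | rfl | rfl
      · exact Or.inl rfl
      · rcases hx' with h | h | h
        · exact Or.inl h
        · exact absurd h n5
        · exact Or.inr h
      · exact Or.inr rfl
    · simp [n1, n2.symm, hcm, hcm.symm]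
    · simp [n3, n4.symm, hcm, hcm.symm]
    · simp [n2, n3, n5, n1.symm, n4.symm, hcm, hcm.symm]
    · refine hCK.trans (compl_subset_compl.2 ?_)
      simp only [PlaneDrawing.trace, SimpleGraph.Walk.edges_cons, SimpleGraph.Walk.edges_nil,
        List.mem_cons, List.not_mem_nil, or_false, iUnion_iUnion_eq_or_left, iUnion_iUnion_eq_left,
        union_subset_iff]
      exact ⟨⟨harcK _ _ hij, harcK _ _ hki, harcK _ _ hkj⟩, harcK _ _ hli, harcK _ _ hlj⟩
    · simpa [PlaneDrawing.trace] using hz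
    · exact D.pos_mem_trace _ hcm (by simp)
    · exact D.pos_mem_trace _ hcm (by simp)
  set T : Set Plane := range fun i => D.pos (f i) with hT
  have hfr : frontier C ⊆ T := by
    intro x hx
    have hxK : x ∈ K := by
      by_contra hxK
      have hox : IsOpen (connectedComponentIn Kᶜ x) := hKc.isOpen_compl.connectedComponentIn
      obtain ⟨y, hyx, hyC⟩ := mem_closure_iff.1 hx.1 _ hox (mem_connectedComponentIn hxK)
      have : C = connectedComponentIn Kᶜ x :=
        (connectedComponentIn_eq hyC).trans (connectedComponentIn_eq hyx).symm
      refine hx.2 ?_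
      rw [hCo.interior_eq, this]
      exact mem_connectedComponentIn hxK
    simp only [hK, mem_iUnion] at hxK
    obtain ⟨i, j, hij, hx'⟩ := hxK
    rcases hmiss i j hij x hx' hx.1 with h | h
    · exact ⟨i, h.symm⟩
    · exact ⟨j, h.symm⟩
  -- The boundary of `C` is thus contained in four points. Removing them leaves the plane connected,
  -- yet this connected set contains points of `C` and the midpoint of an edge, which is not in `C`.
  have hTc : IsConnected Tᶜ := (finite_range _).countable.isConnected_compl_of_one_lt_rank (by
    rw [← Module.finrank_eq_rank]
    simp [Plane])
  have hTK : T ⊆ K := by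
    rintro _ ⟨i, rfl⟩; exact hposK i
  have huC : u ∈ C := hUC hu
  obtain ⟨x, hxT, hxf⟩ := inter_frontier_nonempty_of_isPreconnected hTc.isPreconnected hCo
    ⟨u, fun h => hUK hu (hTK h), huC⟩ (by
      obtain ⟨γ, hγ, hr⟩ := D.isSimpleArc _ _ (hf 0 1 (by decide))
      let t : unitInterval := ⟨1 / 2, by norm_num, by norm_num⟩
      have hmem : γ t ∈ D.arc s(f 0, f 1) := hr ▸ mem_range_self t
      refine ⟨γ t, ?_, fun h => hCK h (harcK 0 1 (by decide) hmem)⟩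
      rintro ⟨i, hi⟩
      have hi' : D.pos (f i) = γ t := hi
      have := D.mem_of_pos_mem _ (hf 0 1 (by decide)) (f i) (hi' ▸ hmem)
      rcases Sym2.mem_iff.1 this with h | h
      · rw [h] at hi'
        have := congr_arg Subtype.val (hγ (γ.source.trans hi'))
        norm_num [t] at this
      · rw [h] at hi'
        have := congr_arg Subtype.val (hγ (γ.target.trans hi'))
        norm_num [t] at this)
  exact hxT (hfr hxf)

end Minors

end OuterplanarSpread

/-! ### Distance levels and the number of edges -/

namespace OuterplanarSpread

section EdgeBound

variable {V : Type*} {G : SimpleGraph V}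

theorem exists_adj_dist_pred {r u : V} {k : ℕ} (h : G.Reachable r u) (hk : G.dist r u = k + 1) :
    ∃ u', G.Adj u' u ∧ G.Reachable r u' ∧ G.dist r u' = k := by
  obtain ⟨p, hp⟩ := h.symm.exists_walk_length_eq_dist
  rw [SimpleGraph.dist_comm, hk] at hp
  cases p with
  | nil => simp at hp
  | @cons _ u' _ hadj p =>
    have hr : G.Reachable r u' := p.reachable.symm
    refine ⟨u', hadj.symm, hr, ?_⟩
    have h1 : G.dist r u' ≤ k := by
      rw [SimpleGraph.dist_comm]
      refine (SimpleGraph.dist_le p).trans ?_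
      simp at hp; omega
    obtain ⟨q, hq⟩ := hr.exists_walk_length_eq_dist
    have h2 := SimpleGraph.dist_le (q.concat hadj.symm)
    rw [SimpleGraph.Walk.length_concat, hq, hk] at h2
    omega

theorem preconnected_induce_ball (r : V) (k : ℕ) :
    (G.induce {u | G.Reachable r u ∧ G.dist r u ≤ k}).Preconnected := by
  set S : Set V := {u | G.Reachable r u ∧ G.dist r u ≤ k}
  have hr : r ∈ S := ⟨SimpleGraph.Reachable.refl r, by simp⟩
  have key : ∀ (d : ℕ) (u : V) (hu : u ∈ S), G.dist r u = d →
      (G.induce S).Reachable ⟨r, hr⟩ ⟨u, hu⟩ := by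
    intro d
    induction d with
    | zero =>
      intro u hu hd
      obtain rfl := hu.1.dist_eq_zero_iff.1 hd
      exact SimpleGraph.Reachable.refl _
    | succ d ih =>
      intro u hu hd
      obtain ⟨u', hadj, hr', hd'⟩ := exists_adj_dist_pred hu.1 hd
      have hu' : u' ∈ S := ⟨hr', by have := hu.2; omega⟩
      exact (ih u' hu' hd').trans (SimpleGraph.Adj.reachable (SimpleGraph.induce_adj.2 hadj))
  intro a b
  exact (key _ a.1 a.2 rfl).symm.trans (key _ b.1 b.2 rfl)

/-- Three such neighbours have predecessors in the ball of radius `j - 1` about `r`. This ball is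
connected and contains neither `v` nor the neighbours, so contracting it gives `K_{2,3}`. Level 0 is
the root alone. -/
theorem IsOuterplanar.card_level_le (h : IsOuterplanar G) [Fintype V] [DecidableRel G.Adj]
    {r v : V} {j : ℕ} (hr : G.Reachable r v) (hj : j ≤ G.dist r v) :
    (Finset.univ.filter fun u => G.Adj v u ∧ G.dist r u = j).card ≤ 2 := by
  classical
  by_contra! hcard
  obtain ⟨y₁, y₂, y₃, h1, h2, h3, h12, h13, h23⟩ := Finset.two_lt_card_iff.1 hcard
  simp only [Finset.mem_filter, Finset.mem_univ, true_and] at h1 h2 h3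
  have hre : ∀ {y}, G.Adj v y → G.Reachable r y := fun hy => hr.trans hy.reachable
  cases j with
  | zero =>
    have e1 := (hre h1.1).dist_eq_zero_iff.1 h1.2
    have e2 := (hre h2.1).dist_eq_zero_iff.1 h2.2
    exact h12 (e1.symm.trans e2)
  | succ k =>
    obtain ⟨x₁, a1, r1, d1⟩ := exists_adj_dist_pred (hre h1.1) h1.2
    obtain ⟨x₂, a2, r2, d2⟩ := exists_adj_dist_pred (hre h2.1) h2.2
    obtain ⟨x₃, a3, r3, d3⟩ := exists_adj_dist_pred (hre h3.1) h3.2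
    refine h.not_minor (preconnected_induce_ball r k) (c := v) (y₁ := y₁) (y₂ := y₂) (y₃ := y₃)
      ?_ ?_ ?_ ?_ h12 h13 h23 h1.1 h2.1 h3.1 a1.symm a2.symm a3.symm
      ⟨r1, d1.le⟩ ⟨r2, d2.le⟩ ⟨r3, d3.le⟩
    · rintro ⟨-, hd⟩; omega
    · rintro ⟨-, hd⟩; omega
    · rintro ⟨-, hd⟩; omega
    · rintro ⟨-, hd⟩; omega

theorem dist_le_dist_succ_of_adj {r u v : V} (hr : G.Reachable r u) (huv : G.Adj u v) :
    G.dist r v ≤ G.dist r u + 1 := by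
  obtain ⟨q, hq⟩ := hr.exists_walk_length_eq_dist
  simpa [hq] using SimpleGraph.dist_le (q.concat huv)

/-- An outerplanar graph on `n` vertices has at most `3 n` edges. -/
theorem IsOuterplanar.sum_degree_le (h : IsOuterplanar G) [Fintype V] [DecidableRel G.Adj] :
    ∑ v, G.degree v ≤ 6 * Fintype.card V := by
  classical
  let root : V → V := fun v => (G.connectedComponentMk v).out
  have hroot : ∀ v, G.Reachable (root v) v := fun v =>
    SimpleGraph.ConnectedComponent.exact (Quot.out_eq (G.connectedComponentMk v))
  have hadj : ∀ {u v}, G.Adj u v → root u = root v := fun huv => by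
    simp only [root, SimpleGraph.ConnectedComponent.eq.2 huv.reachable]
  let l : V → ℕ := fun v => G.dist (root v) v
  have hl : ∀ {u v}, G.Adj u v → l v ≤ l u + 1 := fun {u v} huv => by
    simp only [l, ← hadj huv]
    exact dist_le_dist_succ_of_adj (hroot u) huv
  have hsame : ∀ v, (Finset.univ.filter fun u => G.Adj v u ∧ l u = l v).card ≤ 2 := by
    intro v
    refine (Finset.card_le_card ?_).trans (h.card_level_le (hroot v) le_rfl)
    intro u hu
    simp only [Finset.mem_filter, Finset.mem_univ, true_and] at hu ⊢
    refine ⟨hu.1, ?_⟩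
    have h2 : G.dist (root v) u = l u := by rw [hadj hu.1]
    exact h2.trans hu.2
  have hlow : ∀ v, (Finset.univ.filter fun u => G.Adj v u ∧ l u < l v).card ≤ 2 := by
    intro v
    -- Lower neighbours lie exactly one level down. Truncation at level 0 is harmless, since nothing
    -- is lower.
    refine (Finset.card_le_card ?_).trans (h.card_level_le (hroot v) (Nat.sub_le _ 1))
    intro u hu
    simp only [Finset.mem_filter, Finset.mem_univ, true_and] at hu ⊢
    refine ⟨hu.1, ?_⟩
    have h1 := hl hu.1.symm
    have h2 : G.dist (root v) u = l u := by rw [hadj hu.1]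
    have h3 : G.dist (root v) v = l v := rfl
    rw [h2, h3]
    omega
  -- Upward and downward incidences are equinumerous, so the degree sum is at most `2n + 2 * 2n`.
  have hsymm : ∑ v, (Finset.univ.filter fun u => G.Adj v u ∧ l v < l u).card =
      ∑ v, (Finset.univ.filter fun u => G.Adj v u ∧ l u < l v).card := by
    simp only [Finset.card_filter]
    rw [Finset.sum_comm]
    refine Finset.sum_congr rfl fun v _ => Finset.sum_congr rfl fun u _ => ?_
    simp only [G.adj_comm]
  have hdeg : ∀ v, G.degree v = (Finset.univ.filter fun u => G.Adj v u ∧ l u = l v).card +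
      (Finset.univ.filter fun u => G.Adj v u ∧ l u < l v).card +
      (Finset.univ.filter fun u => G.Adj v u ∧ l v < l u).card := by
    intro v
    rw [← SimpleGraph.card_neighborFinset_eq_degree, SimpleGraph.neighborFinset_eq_filter]
    simp only [Finset.card_filter, ← Finset.sum_add_distrib]
    refine Finset.sum_congr rfl fun u _ => ?_
    by_cases hA : G.Adj v u
    · rcases lt_trichotomy (l u) (l v) with h | h | h
      · simp [hA, h, h.ne, h.not_gt]
      · simp [hA, h]
      · simp [hA, h, h.ne', h.not_gt]
    · simp [hA]
  simp only [hdeg, Finset.sum_add_distrib, hsymm]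
  have s1 : ∑ v, (Finset.univ.filter fun u => G.Adj v u ∧ l u = l v).card ≤
      Fintype.card V * 2 := by
    simpa using Finset.sum_le_card_nsmul Finset.univ _ 2 fun v _ => hsame v
  have s2 : ∑ v, (Finset.univ.filter fun u => G.Adj v u ∧ l u < l v).card ≤
      Fintype.card V * 2 := by
    simpa using Finset.sum_le_card_nsmul Finset.univ _ 2 fun v _ => hlow v
  omega

theorem IsOuterplanar.card_common_le (h : IsOuterplanar G) [Fintype V] [DecidableRel G.Adj]
    {u v : V} (huv : u ≠ v) : (Finset.univ.filter fun x => G.Adj u x ∧ G.Adj v x).card ≤ 2 := by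
  classical
  by_contra! hcard
  obtain ⟨y₁, y₂, y₃, h1, h2, h3, h12, h13, h23⟩ := Finset.two_lt_card_iff.1 hcard
  simp only [Finset.mem_filter, Finset.mem_univ, true_and] at h1 h2 h3
  exact h.not_k23 huv h12 h13 h23 h1.1 h2.1 h3.1 h1.2 h2.2 h3.2

end EdgeBound

/-! ### Neighbourhoods and linear forests -/

section LinearForest

/-- `f 0, …, f (m - 1)` are the successive vertices of a path in `K`. -/
def IsPathSeq {C : Type*} (K : SimpleGraph C) (m : ℕ) (f : ℕ → C) : Prop :=
  (∀ i < m, ∀ j < m, f i = f j → i = j) ∧ ∀ i, i + 1 < m → K.Adj (f i) (f (i + 1))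

/-- Take a longest path. A neighbour off it would extend it at an end or give an inner vertex degree
three, so by connectedness it spans. A chord would give degree three or close the whole path to a
cycle. -/
theorem nonempty_iso_pathGraph {C : Type*} [Finite C] {K : SimpleGraph C} (hK : K.Connected)
    (hdeg : ∀ x y₁ y₂ y₃, K.Adj x y₁ → K.Adj x y₂ → K.Adj x y₃ → y₁ ≠ y₂ → y₁ ≠ y₃ → y₂ ≠ y₃ →
      False)
    (hcyc : ∀ m f, 3 ≤ m → IsPathSeq K m f → ¬ K.Adj (f 0) (f (m - 1))) :
    ∃ k : ℕ, Nonempty (K ≃g SimpleGraph.pathGraph k) := by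
  classical
  have := Fintype.ofFinite C
  obtain ⟨c₀⟩ := hK.nonempty
  have hbound : ∀ m f, IsPathSeq K m f → m ≤ Fintype.card C := by
    intro m f hf
    have := Fintype.card_le_of_injective (fun i : Fin m => f i)
      (fun i j hij => Fin.ext (hf.1 i i.2 j j.2 hij))
    simpa using this
  let P : ℕ → Prop := fun m => ∃ f, IsPathSeq K m f
  have hP1 : P 1 := ⟨fun _ => c₀, fun i hi j hj _ => by omega, fun i hi => by omega⟩
  have hcard : 1 ≤ Fintype.card C := Fintype.card_pos_iff.2 ⟨c₀⟩
  set m := Nat.findGreatest P (Fintype.card C) with hm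
  have hPm : P m := Nat.findGreatest_spec hcard hP1
  have hm1 : 1 ≤ m := Nat.le_findGreatest hcard hP1
  have hmax : ∀ f, ¬ IsPathSeq K (m + 1) f := fun f hf => by
    have := Nat.le_findGreatest (hbound _ f hf) (show P (m + 1) from ⟨f, hf⟩)
    omega
  obtain ⟨f, hinj, hadj⟩ := hPm
  have hmem : ∀ i < m, ∀ y, K.Adj (f i) y → ∃ j < m, y = f j := by
    intro i hi y hy
    by_contra! hcon
    by_cases hi0 : i = 0
    · subst hi0
      refine hmax (fun j => if j = 0 then y else f (j - 1)) ⟨?_, ?_⟩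
      · intro a ha b hb hab
        by_cases ha0 : a = 0 <;> by_cases hb0 : b = 0
        · omega
        · simp only [ha0, hb0, if_true, if_false] at hab
          exact absurd hab (hcon _ (by omega))
        · simp only [ha0, hb0, if_true, if_false] at hab
          exact absurd hab.symm (hcon _ (by omega))
        · simp only [ha0, hb0, if_false] at hab
          have := hinj _ (by omega) _ (by omega) hab
          omega
      · intro a ha
        by_cases ha0 : a = 0
        · subst ha0; simpa using hy.symm
        · have := hadj (a - 1) (by omega)
          rw [Nat.sub_add_cancel (by omega)] at this
          simpa [ha0] using this
    by_cases him : i + 1 = m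
    · refine hmax (fun j => if j = m then y else f j) ⟨?_, ?_⟩
      · intro a ha b hb hab
        by_cases ha0 : a = m <;> by_cases hb0 : b = m
        · omega
        · simp only [ha0, hb0, if_true, if_false] at hab
          exact absurd hab (hcon _ (by omega))
        · simp only [ha0, hb0, if_true, if_false] at hab
          exact absurd hab.symm (hcon _ (by omega))
        · simp only [ha0, hb0, if_false] at hab
          exact hinj _ (by omega) _ (by omega) hab
      · intro a ha
        have ha0 : a ≠ m := by omega
        by_cases ha1 : a + 1 = m
        · obtain rfl : a = i := by omega
          simpa [ha0, ha1] using hy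
        · simpa [ha0, ha1] using hadj a (by omega)
    have h1 := hadj (i - 1) (by omega)
    rw [Nat.sub_add_cancel (by omega)] at h1
    refine hdeg _ _ _ _ h1.symm (hadj i (by omega)) hy (fun h => ?_)
      (hcon _ (by omega)).symm (hcon _ (by omega)).symm
    have := hinj _ (by omega) _ (by omega) h
    omega
  have hcons : ∀ i j, i < j → j < m → K.Adj (f i) (f j) → i + 1 = j := by
    intro i j hij hj hA
    by_contra hne
    by_cases hi0 : i = 0
    · subst hi0
      by_cases hjm : j = m - 1
      · subst hjm
        exact hcyc m f (by omega) ⟨hinj, hadj⟩ hA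
      · have h1 := hadj (j - 1) (by omega)
        rw [Nat.sub_add_cancel (by omega)] at h1
        refine hdeg _ _ _ _ h1.symm (hadj j (by omega)) hA.symm (fun h => ?_) (fun h => ?_)
          fun h => ?_
        all_goals
          have := hinj _ (by omega) _ (by omega) h
          omega
    · have h1 := hadj (i - 1) (by omega)
      rw [Nat.sub_add_cancel (by omega)] at h1
      refine hdeg _ _ _ _ h1.symm (hadj i (by omega)) hA (fun h => ?_) (fun h => ?_) fun h => ?_
      all_goals
        have := hinj _ (by omega) _ (by omega) h
        omega
  have hsurj : ∀ x, ∃ j < m, x = f j := by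
    intro x
    obtain ⟨p⟩ := hK.preconnected x (f 0)
    have : ∀ {a b : C} (p : K.Walk a b), (∃ j < m, b = f j) → ∃ j < m, a = f j := by
      intro a b p
      induction p with
      | nil => exact id
      | cons h p ih =>
        intro hb
        obtain ⟨j, hj, hja⟩ := ih hb
        exact hmem j hj _ (hja ▸ h.symm)
    exact this p ⟨0, hm1, rfl⟩
  have hbij : Function.Bijective fun i : Fin m => f i := by
    refine ⟨fun i j hij => Fin.ext (hinj i i.2 j j.2 hij), fun x => ?_⟩
    obtain ⟨j, hj, rfl⟩ := hsurj x
    exact ⟨⟨j, hj⟩, rfl⟩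
  refine ⟨m, ⟨SimpleGraph.Iso.symm ⟨Equiv.ofBijective _ hbij, ?_⟩⟩⟩
  · intro i j
    simp only [Equiv.ofBijective_apply, SimpleGraph.pathGraph_adj]
    constructor
    · intro hA
      rcases lt_trichotomy (i : ℕ) j with h | h | h
      · exact Or.inl (hcons _ _ h j.2 hA)
      · rw [Fin.ext h] at hA; exact absurd rfl hA.ne
      · exact Or.inr (hcons _ _ h i.2 hA.symm)
    · rintro (h | h)
      · rw [← h]; exact hadj i (by omega)
      · rw [← h]; exact (hadj j (by omega)).symm

theorem preconnected_induce_pathSeq {V : Type*} {G : SimpleGraph V} {f : ℕ → V} {a m : ℕ}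
    (hadj : ∀ i, i + 1 < m → G.Adj (f i) (f (i + 1))) :
    (G.induce {x | ∃ i, a ≤ i ∧ i < m ∧ x = f i}).Preconnected := by
  set S : Set V := {x | ∃ i, a ≤ i ∧ i < m ∧ x = f i} with hS
  have key : ∀ d, ∀ (h : a + d < m), (G.induce S).Reachable ⟨f a, a, le_rfl, by omega, rfl⟩
      ⟨f (a + d), a + d, by omega, h, rfl⟩ := by
    intro d
    induction d with
    | zero => intro h; exact SimpleGraph.Reachable.refl _
    | succ d ih =>
      intro h
      refine (ih (by omega)).trans (SimpleGraph.Adj.reachable (SimpleGraph.induce_adj.2 ?_))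
      exact hadj _ h
  have key' : ∀ x : S, ∃ h : f a ∈ S, (G.induce S).Reachable ⟨f a, h⟩ x := by
    rintro ⟨x, i, hai, him, rfl⟩
    refine ⟨⟨a, le_rfl, by omega, rfl⟩, ?_⟩
    have := key (i - a) (by omega)
    simpa only [Nat.add_sub_cancel' hai] using this
  intro x y
  obtain ⟨_, hx⟩ := key' x
  obtain ⟨_, hy⟩ := key' y
  exact hx.symm.trans hy

/-- In an outerplanar graph the neighbourhood of a vertex induces a linear forest. -/
theorem IsOuterplanar.isLinearForest {V W : Type*} [Finite W] {G : SimpleGraph V}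
    (h : IsOuterplanar G) {w : V} {H : SimpleGraph W} {e : W → V} (he : Function.Injective e)
    (hH : ∀ x y, H.Adj x y → G.Adj (e x) (e y) ∧ G.Adj w (e x) ∧ G.Adj w (e y)) :
    IsLinearForest H := by
  intro c
  have hadj : ∀ {x y : c}, c.toSimpleGraph.Adj x y → H.Adj x y := fun h => h
  refine nonempty_iso_pathGraph c.connected_toSimpleGraph ?_ ?_
  · intro x y₁ y₂ y₃ h1 h2 h3 h12 h13 h23
    have g1 := hH _ _ (hadj h1)
    have g2 := hH _ _ (hadj h2)
    have g3 := hH _ _ (hadj h3)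
    have hne : ∀ {a b : c}, a ≠ b → e a ≠ e b := fun h => he.ne (Subtype.val_injective.ne h)
    -- A vertex with three neighbours in `H` shares them with `w`.
    exact h.not_k23 g1.2.1.ne (hne h12) (hne h13) (hne h23) g1.2.2 g2.2.2 g3.2.2 g1.1 g2.1 g3.1
  · intro m f hm hf hcl
    let g : ℕ → V := fun i => e (f i)
    have hginj : ∀ i < m, ∀ j < m, g i = g j → i = j := fun i hi j hj hij =>
      hf.1 i hi j hj (Subtype.val_injective (he hij))
    have hgadj : ∀ i, i + 1 < m → G.Adj (g i) (g (i + 1)) := fun i hi =>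
      (hH _ _ (hadj (hf.2 i hi))).1
    have hgcl : G.Adj (g 0) (g (m - 1)) := (hH _ _ (hadj hcl)).1
    have hgw : ∀ i < m, G.Adj w (g i) := by
      intro i hi
      by_cases him : i + 1 < m
      · exact (hH _ _ (hadj (hf.2 i him))).2.1
      · have := (hH _ _ (hadj (hf.2 (i - 1) (by omega)))).2.2
        rwa [Nat.sub_add_cancel (by omega)] at this
    by_cases hm3 : m = 3
    · subst hm3
      have a01 := hgadj 0 (by omega)
      have a12 := hgadj 1 (by omega)
      have a02 : G.Adj (g 0) (g 2) := hgcl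
      have w0 := hgw 0 (by omega)
      have w1 := hgw 1 (by omega)
      have w2 := hgw 2 (by omega)
      refine h.not_k4 (f := ![w, g 0, g 1, g 2]) fun i j hij => ?_
      fin_cases i <;> fin_cases j <;>
        first
          | exact absurd rfl hij
          | assumption
          | (apply SimpleGraph.Adj.symm; assumption)
    -- In a longer cycle `g 1` and the contracted segment from `g 3` to `g (m - 1)` are both joined
    -- to `g 0`, `g 2` and `w`. A triangle was excluded as it forms `K₄` with `w`.
    · refine h.not_minor (preconnected_induce_pathSeq (a := 3) hgadj) (c := g 1) (y₁ := g 0)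
        (y₂ := g 2) (y₃ := w) (x₁ := g (m - 1)) (x₂ := g 3) (x₃ := g 3) ?_ ?_ ?_ ?_ ?_ ?_ ?_
        (hgadj 0 (by omega)).symm (hgadj 1 (by omega)) (hgw 1 (by omega)).symm hgcl
        (hgadj 2 (by omega)) (hgw 3 (by omega)) ⟨m - 1, by omega, by omega, rfl⟩
        ⟨3, le_rfl, by omega, rfl⟩ ⟨3, le_rfl, by omega, rfl⟩
      · rintro ⟨i, hi, him, h⟩
        have := hginj _ (by omega) _ (by omega) h; omega
      · rintro ⟨i, hi, him, h⟩
        have := hginj _ (by omega) _ (by omega) h; omega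
      · rintro ⟨i, hi, him, h⟩
        have := hginj _ (by omega) _ (by omega) h; omega
      · rintro ⟨i, hi, him, h⟩
        exact (hgw i him).ne h
      · intro h
        have := hginj _ (by omega) _ (by omega) h; omega
      · exact (hgw 0 (by omega)).ne'
      · exact (hgw 2 (by omega)).ne'

/-- The vertices of a linear forest can be numbered so that neighbours have consecutive
numbers. -/
theorem IsLinearForest.exists_numbering {W : Type*} [Finite W] {H : SimpleGraph W}
    (h : IsLinearForest H) :
    ∃ f : W → ℕ, Function.Injective f ∧ ∀ x y, H.Adj x y → f y = f x + 1 ∨ f x = f y + 1 := by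
  classical
  have := Fintype.ofFinite W
  choose k hk using h
  have φ : ∀ c, c.toSimpleGraph ≃g SimpleGraph.pathGraph (k c) := fun c => (hk c).some
  let ι : ∀ x : W, (H.connectedComponentMk x).supp := fun x => ⟨x, rfl⟩
  obtain ⟨N, hN⟩ : ∃ N, ∀ c, k c ≤ N := by
    obtain ⟨N, hN⟩ := (Set.finite_range k).bddAbove
    exact ⟨N, fun c => hN ⟨c, rfl⟩⟩
  obtain ⟨M, ⟨e⟩⟩ := Finite.exists_equiv_fin H.ConnectedComponent
  let idx : ∀ c : H.ConnectedComponent, c.supp → ℕ := fun c x => (φ c x : ℕ)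
  have hidx : ∀ c x, idx c x < N + 1 := fun c x => by
    have := (φ c x).2
    have := hN c
    simp only [idx]
    omega
  have hidx_inj : ∀ c x y, idx c x = idx c y → x = y := fun c x y hxy =>
    (φ c).injective (Fin.ext hxy)
  -- Each component gets its own block of `N + 1` integers, long enough for every path.
  refine ⟨fun x => (e (H.connectedComponentMk x) : ℕ) * (N + 1) +
    idx _ (ι x), ?_, ?_⟩
  · intro x y hxy
    simp only at hxy
    have hc : H.connectedComponentMk x = H.connectedComponentMk y := by
      apply e.injective
      apply Fin.ext
      have h1 := congr_arg (· / (N + 1)) hxy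
      simpa [Nat.add_div_of_dvd_right, Nat.mul_add_div, Nat.div_eq_of_lt (hidx _ _),
        mul_comm _ (N + 1)] using h1
    have key : ∀ (c c' : H.ConnectedComponent) (hcc : c = c') (a : c.supp) (b : c'.supp),
        idx c a = idx c' b → (a : W) = b := by
      rintro c _ rfl a b hab
      rw [hidx_inj c a b hab]
    refine key _ _ hc (ι x) (ι y) ?_
    rw [show (e (H.connectedComponentMk x) : ℕ) = e (H.connectedComponentMk y) by rw [hc]] at hxy
    exact Nat.add_left_cancel hxy
  · intro x y hxy
    have hc : H.connectedComponentMk x = H.connectedComponentMk y :=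
      SimpleGraph.ConnectedComponent.eq.2 hxy.reachable
    have key : ∀ (c c' : H.ConnectedComponent) (hcc : c = c') (a : c.supp) (b : c'.supp),
        H.Adj a b → idx c' b = idx c a + 1 ∨ idx c a = idx c' b + 1 := by
      rintro c _ rfl a b hab
      have h1 : (SimpleGraph.pathGraph (k c)).Adj (φ c a) (φ c b) := (φ c).map_rel_iff.2 hab
      rw [SimpleGraph.pathGraph_adj] at h1
      rcases h1 with h1 | h1
      · exact Or.inl h1.symm
      · exact Or.inr h1.symm
    have := key _ _ hc (ι x) (ι y) hxy
    simp only [hc] at this ⊢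
    omega

end LinearForest

end OuterplanarSpread

/-! ### Drawing a cone over a linear forest on a parabola -/

namespace OuterplanarSpread

section Fan

/-- The point of abscissa `x` and height `x ^ 2 - t` in the plane. -/
noncomputable def belowParabola (x t : ℝ) : Plane := !₂[x, x ^ 2 - t]

theorem continuous_belowParabola : Continuous fun p : ℝ × ℝ => belowParabola p.1 p.2 := by
  unfold belowParabola
  refine (PiLp.continuous_toLp 2 _).comp (continuous_pi fun i => ?_)
  fin_cases i
  · exact continuous_fst
  · simp
    fun_prop

/-- The point of abscissa `k` on the standard parabola. -/
noncomputable def parabola (k : ℕ) : Plane := !₂[(k : ℝ), (k : ℝ) ^ 2]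

theorem parabola_injective : Function.Injective parabola := by
  intro a b h
  have := congr_arg (fun z : Plane => z 0) h
  simpa [parabola] using this

/-- The product is the height of the chord above the parabola; crossings of chords are decided by
comparing such heights. -/
theorem mem_segment_parabola {a b : ℕ} (hab : a < b) {z : Plane}
    (hz : z ∈ segment ℝ (parabola a) (parabola b)) :
    (a : ℝ) ≤ z 0 ∧ z 0 ≤ b ∧ z 1 = z 0 ^ 2 + (z 0 - a) * (b - z 0) := by
  obtain ⟨s, t, hs, ht, hst, rfl⟩ := hz
  have hab' : (a : ℝ) < b := by exact_mod_cast hab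
  have hs' : s = 1 - t := by linarith
  subst hs'
  simp only [parabola, PiLp.add_apply, PiLp.smul_apply, smul_eq_mul]
  simp only [cons_val_zero, cons_val_one]
  refine ⟨by nlinarith, by nlinarith, by ring⟩

theorem eq_parabola {z : Plane} {k : ℕ} (h0 : z 0 = k) (h1 : z 1 = (k : ℝ) ^ 2) :
    z = parabola k := by
  ext i
  fin_cases i
  · simpa [parabola] using h0
  · simpa [parabola] using h1

/-- Chords that do not interleave and share no end are either side by side or nested, and in the
nested case the outer one is strictly higher. -/
theorem exists_common_endpoint {a b c d : ℕ}
    (hne : ¬ (a = c ∧ b = d)) (h1 : ¬ (a < c ∧ c < b ∧ b < d)) (h2 : ¬ (c < a ∧ a < d ∧ d < b))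
    {x : ℝ} (hxa : (a : ℝ) ≤ x) (hxb : x ≤ b) (hxc : (c : ℝ) ≤ x) (hxd : x ≤ d)
    (hx : (x - a) * (b - x) = (x - c) * (d - x)) :
    ∃ k : ℕ, x = k ∧ (k = a ∨ k = b) ∧ (k = c ∨ k = d) := by
  by_cases hac : a = c
  · subst hac
    have hbd : (b : ℝ) - d ≠ 0 := sub_ne_zero.2 fun h => hne ⟨rfl, by exact_mod_cast h⟩
    have : (x - a) * ((b : ℝ) - d) = 0 := by linear_combination hx
    exact ⟨a, by linarith [(mul_eq_zero.1 this).resolve_right hbd], Or.inl rfl, Or.inl rfl⟩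
  by_cases hbd : b = d
  · subst hbd
    have hac' : (a : ℝ) - c ≠ 0 := sub_ne_zero.2 fun h => hac (by exact_mod_cast h)
    have : (b - x) * ((a : ℝ) - c) = 0 := by linear_combination -hx
    exact ⟨b, by linarith [(mul_eq_zero.1 this).resolve_right hac'], Or.inr rfl, Or.inr rfl⟩
  by_cases hbc : b ≤ c
  · have hbc' : (b : ℝ) ≤ c := by exact_mod_cast hbc
    have hxeq : x = b := by linarith
    have : b = c := by
      have : (b : ℝ) = c := by linarith
      exact_mod_cast this
    exact ⟨b, hxeq, Or.inr rfl, Or.inl this⟩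
  by_cases hda : d ≤ a
  · have hda' : (d : ℝ) ≤ a := by exact_mod_cast hda
    have hxeq : x = a := by linarith
    have : a = d := by
      have : (a : ℝ) = d := by linarith
      exact_mod_cast this
    exact ⟨a, hxeq, Or.inl rfl, Or.inr this⟩
  exfalso
  by_cases hlt : a < c
  · have h3 : d < b := by omega
    have e1 : (a : ℝ) < c := by exact_mod_cast hlt
    have e2 : (d : ℝ) < b := by exact_mod_cast h3
    nlinarith [mul_nonneg (sub_nonneg.2 hxc) (sub_nonneg.2 hxd),
      mul_pos (sub_pos.2 e1) (sub_pos.2 e2), mul_nonneg (sub_nonneg.2 hxc) (sub_pos.2 e2).le,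
      mul_nonneg (sub_nonneg.2 hxd) (sub_pos.2 e1).le]
  · have e1 : (c : ℝ) < a := by exact_mod_cast (by omega : c < a)
    have e2 : (b : ℝ) < d := by exact_mod_cast (by omega : b < d)
    nlinarith [mul_nonneg (sub_nonneg.2 hxa) (sub_nonneg.2 hxb),
      mul_pos (sub_pos.2 e1) (sub_pos.2 e2), mul_nonneg (sub_nonneg.2 hxa) (sub_pos.2 e2).le,
      mul_nonneg (sub_nonneg.2 hxb) (sub_pos.2 e1).le]

theorem isSimpleArc_segment {p q : Plane} (h : p ≠ q) : IsSimpleArc (segment ℝ p q) p q := by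
  refine ⟨⟨⟨fun t : unitInterval => AffineMap.lineMap p q (t : ℝ), by fun_prop⟩, by simp, by simp⟩,
    ?_, ?_⟩
  · intro s t hst
    exact Subtype.ext (AffineMap.lineMap_injective ℝ h hst)
  · rw [segment_eq_image_lineMap]
    ext z
    constructor
    · rintro ⟨t, rfl⟩; exact ⟨t, t.2, rfl⟩
    · rintro ⟨t, ht, rfl⟩; exact ⟨⟨t, ht⟩, rfl⟩

variable {V : Type*} {G : SimpleGraph V}

/-- The segment between the points of a parabola which represent the two ends of an edge. -/
noncomputable def chord (f : V → ℕ) : Sym2 V → Set Plane :=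
  Sym2.lift ⟨fun u v => segment ℝ (parabola (f u)) (parabola (f v)), fun _ _ => segment_symm ℝ _ _⟩

theorem exists_lt_ends {f : V → ℕ} (hf : Function.Injective f) {e : Sym2 V} (he : e ∈ G.edgeSet) :
    ∃ u v, e = s(u, v) ∧ G.Adj u v ∧ f u < f v := by
  induction e using Sym2.ind with
  | _ u v =>
    have hA : G.Adj u v := he
    rcases lt_trichotomy (f u) (f v) with h | h | h
    · exact ⟨u, v, rfl, hA, h⟩
    · exact absurd (hf h) hA.ne
    · exact ⟨v, u, Sym2.eq_swap, hA.symm, h⟩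

/-- The straight-line drawing of a graph with its vertices on a parabola. -/
noncomputable def parabolaDrawing (f : V → ℕ) (hf : Function.Injective f)
    (hG : ∀ u v, G.Adj u v → f u < f v → f u = 0 ∨ f v = f u + 1) : PlaneDrawing G where
  pos v := parabola (f v)
  arc := chord f
  pos_injective := parabola_injective.comp hf
  isSimpleArc u v h := isSimpleArc_segment (parabola_injective.ne (hf.ne h.ne))
  mem_of_pos_mem e he x hx := by
    obtain ⟨u, v, rfl, -, huv⟩ := exists_lt_ends hf he
    obtain ⟨-, -, h⟩ := mem_segment_parabola huv hx
    simp only [parabola, cons_val_zero, cons_val_one] at h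
    have h' : ((f x : ℝ) - f u) * (f v - f x) = 0 := by linarith
    rcases mul_eq_zero.1 h' with h' | h'
    · have : f x = f u := by exact_mod_cast sub_eq_zero.1 h'
      simp [hf this]
    · have : f v = f x := by exact_mod_cast sub_eq_zero.1 h'
      simp [hf this]
  inter_subset e he e' he' hne z hz := by
    obtain ⟨u, v, rfl, hA, huv⟩ := exists_lt_ends hf he
    obtain ⟨u', v', rfl, hA', huv'⟩ := exists_lt_ends hf he'
    obtain ⟨h1, h2, h3⟩ := mem_segment_parabola huv hz.1
    obtain ⟨h1', h2', h3'⟩ := mem_segment_parabola huv' hz.2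
    have g := hG u v hA huv
    have g' := hG u' v' hA' huv'
    obtain ⟨k, hk, hk1, hk2⟩ := exists_common_endpoint
      (fun h => hne (by rw [hf h.1, hf h.2])) (by omega) (by omega) h1 h2 h1' h2'
      (by linarith)
    have hz1 : z 1 = (k : ℝ) ^ 2 := by
      rw [h3, hk]
      rcases hk1 with h | h <;> simp [h]
    have hzk := eq_parabola hk hz1
    have hpt : ∀ x, k = f x → x ∈ s(u, v) → x ∈ s(u', v') →
        z ∈ (fun v => parabola (f v)) '' {x | x ∈ s(u, v) ∧ x ∈ s(u', v')} := fun x hx m m' =>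
      ⟨x, ⟨m, m'⟩, by rw [hzk, hx]⟩
    rcases hk1 with h | h <;> rcases hk2 with h' | h' <;>
      exact hpt _ h (by simp) (by simp [hf (h.symm.trans h')])

/-- A graph all of whose edges join consecutive vertices or contain a fixed vertex, in some
numbering of the vertices, is outerplanar. -/
theorem isOuterplanar_of_numbering [Nonempty V] {f : V → ℕ} (hf : Function.Injective f)
    (hG : ∀ u v, G.Adj u v → f u < f v → f u = 0 ∨ f v = f u + 1) : IsOuterplanar G := by
  set D := parabolaDrawing f hf hG with hD
  -- The region strictly below the parabola is connected and unbounded, avoids all chords, and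
  -- reaches every vertex as the depth tends to 0.
  set U : Set Plane := (fun p : ℝ × ℝ => belowParabola p.1 p.2) '' {p | 0 < p.2} with hU
  have hUp : IsPreconnected U := by
    refine IsPreconnected.image ?_ _ continuous_belowParabola.continuousOn
    refine Convex.isPreconnected ?_
    exact convex_halfSpace_gt (LinearMap.snd ℝ ℝ ℝ).isLinear 0
  have hcar : ∀ z ∈ D.carrier, z 0 ^ 2 ≤ z 1 := by
    rintro z (⟨v, rfl⟩ | hz)
    · simp [hD, parabolaDrawing, parabola]
    · simp only [Set.mem_iUnion] at hz
      obtain ⟨e, he, hz⟩ := hz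
      obtain ⟨u, v, rfl, -, huv⟩ := exists_lt_ends hf he
      obtain ⟨h1, h2, h3⟩ := mem_segment_parabola huv hz
      nlinarith [mul_nonneg (sub_nonneg.2 h1) (sub_nonneg.2 h2)]
  have hUc : U ⊆ D.carrierᶜ := by
    rintro _ ⟨p, hp, rfl⟩ hz
    have := hcar _ hz
    have hp' : 0 < p.2 := hp
    simp only [belowParabola, cons_val_zero, cons_val_one] at this
    linarith
  have hmemU : ∀ x t, 0 < t → belowParabola x t ∈ U := fun x t ht => ⟨(x, t), ht, rfl⟩
  have hp : belowParabola 0 1 ∈ U := hmemU 0 1 one_pos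
  have hUF := hUp.subset_connectedComponentIn hp hUc
  refine ⟨D, _, ⟨belowParabola 0 1, hUc hp, rfl⟩, fun hb => ?_, fun v => ⟨?_, fun h => ?_⟩⟩
  · obtain ⟨R, hR⟩ := (hb.subset hUF).subset_closedBall 0
    have h1 := hR (hmemU 0 (|R| + 1) (by positivity))
    rw [mem_closedBall_zero_iff] at h1
    have h2 := PiLp.norm_apply_le (belowParabola 0 (|R| + 1)) 1
    have hval : (belowParabola 0 (|R| + 1)) 1 = -(|R| + 1) := by simp [belowParabola]
    rw [hval, norm_neg, Real.norm_of_nonneg (by positivity)] at h2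
    linarith [le_abs_self R]
  · refine closure_mono hUF ?_
    have hlim : Filter.Tendsto (fun t : ℝ => belowParabola (f v) t) (nhdsWithin 0 (Set.Ioi 0))
        (nhds (belowParabola (f v) 0)) :=
      ((continuous_belowParabola.comp (Continuous.prodMk_right (f v : ℝ))).tendsto 0).mono_left
        nhdsWithin_le_nhds
    have hv : D.pos v = belowParabola (f v) 0 := by
      simp [hD, parabolaDrawing, parabola, belowParabola]
    rw [hv]
    exact mem_closure_of_tendsto hlim (Filter.eventually_of_mem self_mem_nhdsWithin
      fun t ht => hmemU _ t ht)
  · exact connectedComponentIn_subset _ _ (interior_subset h) (Or.inl ⟨v, rfl⟩)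

/-- Joining a vertex to all others turns a linear forest into an outerplanar graph. -/
theorem IsLinearForest.isOuterplanar_cone [Finite V] {H : SimpleGraph V} (h : IsLinearForest H)
    {w : V} (hG : ∀ u v, G.Adj u v → u = w ∨ v = w ∨ H.Adj u v) : IsOuterplanar G := by
  classical
  have : Nonempty V := ⟨w⟩
  obtain ⟨f, hf, hfH⟩ := h.exists_numbering
  refine isOuterplanar_of_numbering (f := fun v => if v = w then 0 else f v + 1) ?_ ?_
  · intro u v huv
    by_cases hu : u = w <;> by_cases hv : v = w
    · rw [hu, hv]
    · simp [hu, hv] at huv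
    · simp [hu, hv] at huv
    · simp only [hu, hv, if_false] at huv
      exact hf (by omega)
  · intro u v hA hlt
    by_cases hu : u = w
    · simp [hu]
    by_cases hv : v = w
    · simp [hv] at hlt
    · have hH := ((hG u v hA).resolve_left hu).resolve_left hv
      simp only [hu, hv, if_false] at hlt ⊢
      have := hfH u v hH
      omega

end Fan

end OuterplanarSpread

/-! ### Rayleigh quotients and the spread -/

namespace OuterplanarSpread

section Rayleigh

theorem dotProduct_self_pos {V : Type*} [Fintype V] {v : V → ℝ} (hv : v ≠ 0) : 0 < v ⬝ᵥ v :=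
  lt_of_le_of_ne (Finset.sum_nonneg fun i _ => mul_self_nonneg (v i))
    (Ne.symm (by rwa [ne_eq, dotProduct_self_eq_zero]))

variable {V : Type*} [Fintype V] [DecidableEq V]

theorem exists_eigenvector_of_mem_spectrum {A : Matrix V V ℝ} {m : ℝ} (hm : m ∈ spectrum ℝ A) :
    ∃ v : V → ℝ, v ≠ 0 ∧ A *ᵥ v = m • v := by
  rw [spectrum.mem_iff, Matrix.isUnit_iff_isUnit_det, isUnit_iff_ne_zero, not_not] at hm
  obtain ⟨v, hv, h⟩ := Matrix.exists_mulVec_eq_zero_iff.2 hm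
  refine ⟨v, hv, ?_⟩
  rw [Matrix.sub_mulVec, sub_eq_zero, Algebra.algebraMap_eq_smul_one, Matrix.smul_mulVec,
    Matrix.one_mulVec] at h
  exact h.symm

theorem posSemidef_of_spectrum_nonneg {A : Matrix V V ℝ} (hA : A.IsHermitian)
    (h : ∀ x ∈ spectrum ℝ A, 0 ≤ x) : A.PosSemidef :=
  hA.posSemidef_iff_eigenvalues_nonneg.2 fun i => h _ (hA.eigenvalues_mem_spectrum_real i)

theorem posSemidef_sub_of_isGreatest {A : Matrix V V ℝ} (hA : A.IsHermitian) {M : ℝ}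
    (hM : IsGreatest (spectrum ℝ A) M) : (algebraMap ℝ (Matrix V V ℝ) M - A).PosSemidef := by
  refine posSemidef_of_spectrum_nonneg ?_ fun x hx => ?_
  · refine Matrix.IsHermitian.sub ?_ hA
    rw [Algebra.algebraMap_eq_smul_one]
    simp [Matrix.IsHermitian]
  · rw [← spectrum.singleton_sub_eq] at hx
    obtain ⟨_, rfl, y, hy, rfl⟩ := hx
    exact sub_nonneg.2 (hM.2 hy)

theorem posSemidef_sub_of_isLeast {A : Matrix V V ℝ} (hA : A.IsHermitian) {m : ℝ}
    (hm : IsLeast (spectrum ℝ A) m) : (A - algebraMap ℝ (Matrix V V ℝ) m).PosSemidef := by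
  refine posSemidef_of_spectrum_nonneg ?_ fun x hx => ?_
  · refine Matrix.IsHermitian.sub hA ?_
    rw [Algebra.algebraMap_eq_smul_one]
    simp [Matrix.IsHermitian]
  · rw [← spectrum.sub_singleton_eq] at hx
    obtain ⟨y, hy, _, rfl, rfl⟩ := hx
    exact sub_nonneg.2 (hm.2 hy)

theorem rayleigh_le {A : Matrix V V ℝ} (hA : A.IsHermitian) {M : ℝ}
    (hM : IsGreatest (spectrum ℝ A) M) (v : V → ℝ) : v ⬝ᵥ A *ᵥ v ≤ M * (v ⬝ᵥ v) := by
  have := (posSemidef_sub_of_isGreatest hA hM).dotProduct_mulVec_nonneg v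
  rw [Matrix.sub_mulVec, Algebra.algebraMap_eq_smul_one, Matrix.smul_mulVec, Matrix.one_mulVec,
    dotProduct_sub, dotProduct_smul] at this
  simpa using this

theorem le_rayleigh {A : Matrix V V ℝ} (hA : A.IsHermitian) {m : ℝ}
    (hm : IsLeast (spectrum ℝ A) m) (v : V → ℝ) : m * (v ⬝ᵥ v) ≤ v ⬝ᵥ A *ᵥ v := by
  have := (posSemidef_sub_of_isLeast hA hm).dotProduct_mulVec_nonneg v
  rw [Matrix.sub_mulVec, Algebra.algebraMap_eq_smul_one, Matrix.smul_mulVec, Matrix.one_mulVec,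
    dotProduct_sub, dotProduct_smul] at this
  simpa using this

/-- A vector on which a positive semidefinite form vanishes is in the kernel. -/
theorem mulVec_eq_of_rayleigh_eq {A : Matrix V V ℝ} (hA : A.IsHermitian) {M : ℝ}
    (hM : IsGreatest (spectrum ℝ A) M) {v : V → ℝ} (hv : M * (v ⬝ᵥ v) ≤ v ⬝ᵥ A *ᵥ v) :
    A *ᵥ v = M • v := by
  have h := (posSemidef_sub_of_isGreatest hA hM).dotProduct_mulVec_zero_iff v
  have hv' : v ⬝ᵥ A *ᵥ v = M * (v ⬝ᵥ v) := le_antisymm (rayleigh_le hA hM v) hv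
  rw [Matrix.sub_mulVec, Algebra.algebraMap_eq_smul_one, Matrix.smul_mulVec, Matrix.one_mulVec,
    dotProduct_sub, dotProduct_smul, sub_eq_zero, sub_eq_zero] at h
  exact (h.1 (by simpa using hv'.symm)).symm

theorem exists_isGreatest_spectrum [Nonempty V] {A : Matrix V V ℝ} (hA : A.IsHermitian) :
    ∃ M, IsGreatest (spectrum ℝ A) M := by
  obtain ⟨i, hi⟩ := Finite.exists_max hA.eigenvalues
  refine ⟨hA.eigenvalues i, hA.eigenvalues_mem_spectrum_real i, fun x hx => ?_⟩
  rw [hA.spectrum_real_eq_range_eigenvalues] at hx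
  obtain ⟨j, rfl⟩ := hx
  exact hi j

theorem exists_isLeast_spectrum [Nonempty V] {A : Matrix V V ℝ} (hA : A.IsHermitian) :
    ∃ m, IsLeast (spectrum ℝ A) m := by
  obtain ⟨i, hi⟩ := Finite.exists_min hA.eigenvalues
  refine ⟨hA.eigenvalues i, hA.eigenvalues_mem_spectrum_real i, fun x hx => ?_⟩
  rw [hA.spectrum_real_eq_range_eigenvalues] at hx
  obtain ⟨j, rfl⟩ := hx
  exact hi j

end Rayleigh

section Adjacency

theorem isHermitian_adj {V : Type*} {G : SimpleGraph V} : (adj G).IsHermitian := by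
  classical
  rw [Matrix.IsHermitian, Matrix.conjTranspose_eq_transpose_of_trivial]
  exact G.isSymm_adjMatrix

variable {V : Type*} [Fintype V] {G : SimpleGraph V}

theorem adj_mulVec_apply [DecidableRel G.Adj] (x : V → ℝ) (u : V) :
    (adj G *ᵥ x) u = ∑ v, if G.Adj u v then x v else 0 := by
  rw [mulVec, dotProduct]
  refine Finset.sum_congr rfl fun v _ => ?_
  by_cases h : G.Adj u v <;> simp [adj, h]

theorem abs_rayleigh_le (x : V → ℝ) :
    |x ⬝ᵥ adj G *ᵥ x| ≤ (fun u => |x u|) ⬝ᵥ adj G *ᵥ fun u => |x u| := by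
  classical
  simp only [dotProduct, adj_mulVec_apply]
  refine (Finset.abs_sum_le_sum_abs _ _).trans (Finset.sum_le_sum fun u _ => ?_)
  rw [abs_mul]
  refine mul_le_mul_of_nonneg_left ?_ (abs_nonneg _)
  refine (Finset.abs_sum_le_sum_abs _ _).trans (Finset.sum_le_sum fun v _ => ?_)
  split_ifs <;> simp

theorem abs_dotProduct_self (x : V → ℝ) :
    (fun u => |x u|) ⬝ᵥ (fun u => |x u|) = x ⬝ᵥ x := by
  simp [dotProduct]

variable [DecidableEq V]

theorem spread_eq {M m : ℝ} (hM : IsGreatest (spectrum ℝ (adj G)) M)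
    (hm : IsLeast (spectrum ℝ (adj G)) m) : spread G = M - m := by
  have hle : m ≤ M := hm.2 hM.1
  refine le_antisymm (Metric.diam_le_of_forall_dist_le (by linarith) fun x hx y hy => ?_) ?_
  · rw [Real.dist_eq, abs_le]
    have := hM.2 hx
    have := hM.2 hy
    have := hm.2 hx
    have := hm.2 hy
    constructor <;> linarith
  · have := Metric.dist_le_diam_of_mem (Matrix.finite_real_spectrum (A := adj G)).isBounded hM.1 hm.1
    rw [Real.dist_eq] at this
    exact (le_abs_self _).trans this

/-- Two test vectors bound the spread from below without knowledge of the eigenvalues. -/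
theorem sub_le_spread {x z : V → ℝ} {a b : ℝ} (hx : x ≠ 0) (hz : z ≠ 0)
    (ha : a * (x ⬝ᵥ x) ≤ x ⬝ᵥ adj G *ᵥ x) (hb : z ⬝ᵥ adj G *ᵥ z ≤ b * (z ⬝ᵥ z)) :
    a - b ≤ spread G := by
  obtain ⟨i, -⟩ := Function.ne_iff.1 hx
  have : Nonempty V := ⟨i⟩
  obtain ⟨M, hM⟩ := exists_isGreatest_spectrum (isHermitian_adj (G := G))
  obtain ⟨m, hm⟩ := exists_isLeast_spectrum (isHermitian_adj (G := G))
  rw [spread_eq hM hm]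
  have h1 := le_of_mul_le_mul_right (ha.trans (rayleigh_le isHermitian_adj hM x))
    (dotProduct_self_pos hx)
  have h2 := le_of_mul_le_mul_right ((le_rayleigh isHermitian_adj hm z).trans hb)
    (dotProduct_self_pos hz)
  linarith

theorem sub_lt_spread {x z : V → ℝ} {a b : ℝ} (hx : x ≠ 0) (hz : z ≠ 0)
    (ha : a * (x ⬝ᵥ x) < x ⬝ᵥ adj G *ᵥ x) (hb : z ⬝ᵥ adj G *ᵥ z ≤ b * (z ⬝ᵥ z)) :
    a - b < spread G := by
  have hpos := dotProduct_self_pos hx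
  have h := sub_le_spread (a := (x ⬝ᵥ adj G *ᵥ x) / (x ⬝ᵥ x)) hx hz
    (by rw [div_mul_cancel₀ _ hpos.ne']) hb
  have : a < (x ⬝ᵥ adj G *ᵥ x) / (x ⬝ᵥ x) := (lt_div_iff₀ hpos).2 ha
  linarith

/-- Taking absolute values in a top eigenvector does not lower its Rayleigh quotient, so the result
is again an eigenvector. Connectedness of `G` plays no role. -/
theorem exists_isPerronVector [Nonempty V] : ∃ x : V → ℝ, IsPerronVector G x := by
  obtain ⟨M, hM⟩ := exists_isGreatest_spectrum (isHermitian_adj (G := G))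
  obtain ⟨y, hy, hyM⟩ := exists_eigenvector_of_mem_spectrum hM.1
  refine ⟨fun u => |y u|, M, hM, fun h => hy ?_, fun u => abs_nonneg _,
    mulVec_eq_of_rayleigh_eq isHermitian_adj hM ?_⟩
  · ext u
    simpa using congr_fun h u
  · rw [abs_dotProduct_self]
    refine le_trans ?_ (abs_rayleigh_le y)
    rw [hyM, dotProduct_smul, smul_eq_mul]
    exact le_abs_self _

theorem exists_isLeastEigenvector [Nonempty V] : ∃ z : V → ℝ, IsLeastEigenvector G z := by
  obtain ⟨m, hm⟩ := exists_isLeast_spectrum (isHermitian_adj (G := G))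
  obtain ⟨y, hy, hym⟩ := exists_eigenvector_of_mem_spectrum hm.1
  exact ⟨y, m, hm, hy, hym⟩

/-- The least eigenvalue is at most the largest one in absolute value. -/
theorem neg_least_le_greatest {M m : ℝ} (hM : IsGreatest (spectrum ℝ (adj G)) M)
    (hm : IsLeast (spectrum ℝ (adj G)) m) : -m ≤ M := by
  obtain ⟨y, hy, hym⟩ := exists_eigenvector_of_mem_spectrum hm.1
  refine le_of_mul_le_mul_right ?_ (dotProduct_self_pos hy)
  refine le_trans ?_ ((abs_rayleigh_le (G := G) y).trans ?_)
  · rw [hym, dotProduct_smul, smul_eq_mul, neg_mul]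
    exact neg_le_abs _
  · rw [← abs_dotProduct_self y]
    exact rayleigh_le isHermitian_adj hM _

end Adjacency

end OuterplanarSpread

/-! ### Size of eigenvector entries -/

namespace OuterplanarSpread

section EigenvectorBounds

variable {V : Type*} [Fintype V] {G : SimpleGraph V} [DecidableRel G.Adj]

theorem abs_mul_abs_le {ν : ℝ} {y : V → ℝ} (hy : adj G *ᵥ y = ν • y) (u : V) :
    |ν| * |y u| ≤ ∑ v, if G.Adj u v then |y v| else 0 := by
  have h := congr_fun hy u
  rw [adj_mulVec_apply, Pi.smul_apply, smul_eq_mul] at h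
  rw [← abs_mul, ← h]
  refine (Finset.abs_sum_le_sum_abs _ _).trans (Finset.sum_le_sum fun v _ => ?_)
  split_ifs <;> simp

theorem sum_ite_adj (u : V) (c : ℝ) : (∑ v, if G.Adj u v then c else 0) = G.degree u * c := by
  rw [← Finset.sum_filter, ← SimpleGraph.neighborFinset_eq_filter, Finset.sum_const,
    SimpleGraph.card_neighborFinset_eq_degree, nsmul_eq_mul]

/-- Summing the eigenvalue equation over all vertices bounds the left side by the degree sum. -/
theorem IsOuterplanar.abs_mul_sum_le (hG : IsOuterplanar G) {ν : ℝ} {y : V → ℝ}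
    (hy : adj G *ᵥ y = ν • y) (h1 : ∀ u, |y u| ≤ 1) :
    |ν| * ∑ u, |y u| ≤ 6 * Fintype.card V := by
  rw [Finset.mul_sum]
  refine (Finset.sum_le_sum fun u _ => abs_mul_abs_le hy u).trans ?_
  rw [Finset.sum_comm]
  have h2 : ∀ v, (∑ u, if G.Adj u v then |y v| else 0) ≤ G.degree v := by
    intro v
    simp only [G.adj_comm _ v]
    rw [sum_ite_adj]
    exact mul_le_of_le_one_right (Nat.cast_nonneg _) (h1 v)
  refine (Finset.sum_le_sum fun v _ => h2 v).trans ?_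
  exact_mod_cast hG.sum_degree_le

/-- Apply the eigenvalue equation twice: of the walks of length two from `u`, `deg u` return to `u`
and at most two end at any other given vertex. -/
theorem IsOuterplanar.sq_mul_abs_le (hG : IsOuterplanar G) {ν : ℝ} {y : V → ℝ}
    (hy : adj G *ᵥ y = ν • y) (u : V) :
    ν ^ 2 * |y u| ≤ G.degree u * |y u| + 2 * ∑ v, |y v| := by
  classical
  have h1 : ν ^ 2 * |y u| ≤ ∑ v, ∑ t, if G.Adj u v ∧ G.Adj t v then |y t| else 0 := by
    calc ν ^ 2 * |y u| = |ν| * (|ν| * |y u|) := by rw [← sq_abs]; ring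
      _ ≤ |ν| * ∑ v, (if G.Adj u v then |y v| else 0) :=
        mul_le_mul_of_nonneg_left (abs_mul_abs_le hy u) (abs_nonneg _)
      _ = ∑ v, (if G.Adj u v then |ν| * |y v| else 0) := by
        rw [Finset.mul_sum]
        exact Finset.sum_congr rfl fun v _ => by split_ifs <;> simp
      _ ≤ _ := Finset.sum_le_sum fun v _ => by
        by_cases h : G.Adj u v
        · simpa [h, G.adj_comm] using abs_mul_abs_le hy v
        · simp [h]
  rw [Finset.sum_comm] at h1
  have h2 : ∀ t, (∑ v, if G.Adj u v ∧ G.Adj t v then |y t| else 0) ≤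
      (if t = u then G.degree u * |y u| else 0) + 2 * |y t| := by
    intro t
    by_cases htu : t = u
    · subst htu
      simp only [and_self, if_true]
      rw [sum_ite_adj]
      linarith [abs_nonneg (y t)]
    · rw [if_neg htu, zero_add, ← Finset.sum_filter, Finset.sum_const, nsmul_eq_mul]
      refine mul_le_mul_of_nonneg_right ?_ (abs_nonneg _)
      exact_mod_cast hG.card_common_le (Ne.symm htu)
  refine h1.trans ((Finset.sum_le_sum fun t _ => h2 t).trans ?_)
  rw [Finset.sum_add_distrib, ← Finset.mul_sum]
  simp

theorem IsOuterplanar.sq_mul_abs_le_add_div (hG : IsOuterplanar G) {ν : ℝ} {y : V → ℝ}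
    (hy : adj G *ᵥ y = ν • y) (h1 : ∀ u, |y u| ≤ 1) (hν : ν ≠ 0) (u : V) :
    ν ^ 2 * |y u| ≤ G.degree u * |y u| + 12 * Fintype.card V / |ν| := by
  refine (hG.sq_mul_abs_le hy u).trans (add_le_add le_rfl ?_)
  rw [le_div_iff₀ (abs_pos.2 hν)]
  linarith [hG.abs_mul_sum_le hy h1]

theorem IsOuterplanar.degree_add_degree_le [DecidableEq V] (hG : IsOuterplanar G) {u w : V}
    (huw : u ≠ w) : G.degree u + G.degree w ≤ Fintype.card V + 2 := by
  rw [← SimpleGraph.card_neighborFinset_eq_degree, ← SimpleGraph.card_neighborFinset_eq_degree,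
    ← Finset.card_union_add_card_inter]
  refine add_le_add (Finset.card_le_univ _) ?_
  have : G.neighborFinset u ∩ G.neighborFinset w =
      Finset.univ.filter fun x => G.Adj u x ∧ G.Adj w x := by
    ext x; simp
  rw [this]
  exact hG.card_common_le huw

end EigenvectorBounds

/-! ### Replacing a graph by a cone over a link -/

section Cone

variable {V : Type*}

/-- The graph obtained from `H` by joining `w` to all other vertices. -/
def cone (w : V) (H : SimpleGraph V) : SimpleGraph V where
  Adj u v := u ≠ v ∧ (u = w ∨ v = w ∨ H.Adj u v)
  symm := ⟨fun u v h => ⟨h.1.symm, by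
    rcases h.2 with h | h | h
    exacts [Or.inr (Or.inl h), Or.inl h, Or.inr (Or.inr h.symm)]⟩⟩
  loopless := ⟨fun _ h => h.1 rfl⟩

/-- The edges of `G` between neighbours of `w`. -/
def link (G : SimpleGraph V) (w : V) : SimpleGraph V where
  Adj u v := G.Adj u v ∧ G.Adj w u ∧ G.Adj w v
  symm := ⟨fun _ _ h => ⟨h.1.symm, h.2.2, h.2.1⟩⟩
  loopless := ⟨fun _ h => h.1.ne rfl⟩

theorem IsOuterplanar.cone_link [Finite V] {G : SimpleGraph V} (hG : IsOuterplanar G) (w : V) :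
    IsOuterplanar (cone w (link G w)) :=
  (hG.isLinearForest (H := link G w) Function.injective_id fun _ _ h => h).isOuterplanar_cone
    fun _ _ h => h.2

theorem IsOuterplanar.cone_bot [Finite V] {G : SimpleGraph V} (hG : IsOuterplanar G) (w : V) :
    IsOuterplanar (cone w ⊥) :=
  (hG.isLinearForest (w := w) (H := ⊥) Function.injective_id
    fun _ _ h => absurd h (by simp)).isOuterplanar_cone fun _ _ h => h.2

variable [DecidableEq V] {G : SimpleGraph V} [DecidableRel G.Adj]

/-- The test vector on a cone over the link of `w` obtained from an eigenvector of `G`. -/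
noncomputable def testVector (G : SimpleGraph V) [DecidableRel G.Adj] (w : V) (ν : ℝ)
    (y : V → ℝ) (u : V) : ℝ :=
  if u = w then 1 else if G.Adj w u then y u else 1 / ν

theorem testVector_self (w : V) (ν : ℝ) (y : V → ℝ) : testVector G w ν y w = 1 := by
  simp [testVector]

theorem testVector_of_adj {w u : V} (h : G.Adj w u) (ν : ℝ) (y : V → ℝ) :
    testVector G w ν y u = y u := by
  simp [testVector, h, h.ne']

variable [Fintype V]

/-- The vertices different from `w` which are not adjacent to `w`. -/
def nonNeighbors (G : SimpleGraph V) [DecidableRel G.Adj] (w : V) : Finset V :=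
  Finset.univ.filter fun v => v ≠ w ∧ ¬ G.Adj w v

theorem sum_eq_add_sum_neighbors (w : V) (f : V → ℝ) :
    ∑ u, f u = f w + ∑ u ∈ G.neighborFinset w, f u + ∑ u ∈ nonNeighbors G w, f u := by
  have h1 : ∀ u, f u = (if u = w then f w else 0) + (if G.Adj w u then f u else 0) +
      if u ≠ w ∧ ¬ G.Adj w u then f u else 0 := by
    intro u
    by_cases huw : u = w
    · subst huw; simp
    · by_cases h : G.Adj w u <;> simp [huw, h]
  rw [Finset.sum_congr rfl fun u _ => h1 u, Finset.sum_add_distrib, Finset.sum_add_distrib,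
    SimpleGraph.neighborFinset_eq_filter, nonNeighbors, Finset.sum_filter, Finset.sum_filter]
  simp

theorem card_nonNeighbors (w : V) :
    (nonNeighbors G w).card + G.degree w + 1 = Fintype.card V := by
  have h := sum_eq_add_sum_neighbors (G := G) w fun _ => (1 : ℝ)
  simp only [Finset.sum_const, nsmul_eq_mul, mul_one, SimpleGraph.card_neighborFinset_eq_degree,
    Finset.card_univ] at h
  have h' : (((nonNeighbors G w).card + G.degree w + 1 : ℕ) : ℝ) = Fintype.card V := by
    push_cast; linarith
  exact_mod_cast h'

theorem testVector_of_mem {w u : V} (h : u ∈ nonNeighbors G w) (ν : ℝ) (y : V → ℝ) :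
    testVector G w ν y u = 1 / ν := by
  simp only [nonNeighbors, Finset.mem_filter, Finset.mem_univ, true_and] at h
  simp [testVector, h.1, h.2]

/-- The weight of the edges between the neighbours and the nonneighbours of `w`. -/
noncomputable def crossWeight (G : SimpleGraph V) [DecidableRel G.Adj] (w : V) (y : V → ℝ) : ℝ :=
  ∑ u ∈ G.neighborFinset w, ∑ v ∈ nonNeighbors G w, if G.Adj u v then y u * y v else 0

/-- An entry `a` at a non-neighbour contributes `2a` to the form and `a²` to the squared norm. The
excess `2a - ν * a²` is stationary at `a = 1/ν`, with value `1/ν`, which has the sign of `ν`. Edges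
inside the neighbourhood are kept, so the only loss on the neighbours is the cross weight. -/
theorem rayleigh_testVector {w : V} {ν : ℝ} (hν : ν ≠ 0) {y : V → ℝ} (hy : adj G *ᵥ y = ν • y)
    (hw : y w = 1) :
    testVector G w ν y ⬝ᵥ adj (cone w (link G w)) *ᵥ testVector G w ν y =
      ν * (testVector G w ν y ⬝ᵥ testVector G w ν y) + (nonNeighbors G w).card / ν
        - crossWeight G w y := by
  classical
  set t := testVector G w ν y with ht
  have htw : t w = 1 := testVector_self w ν y
  have htA : ∀ u ∈ G.neighborFinset w, t u = y u := fun u hu =>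
    testVector_of_adj (by simpa using hu) ν y
  have htB : ∀ u ∈ nonNeighbors G w, t u = 1 / ν := fun u hu => testVector_of_mem hu ν y
  have hev : ∀ u, ∑ v, (if G.Adj u v then y v else 0) = ν * y u := fun u => by
    rw [← adj_mulVec_apply, hy, Pi.smul_apply, smul_eq_mul]
  set A := G.neighborFinset w with hA
  set B := nonNeighbors G w with hB
  have hAmem : ∀ {u}, u ∈ A ↔ G.Adj w u := by simp [hA]
  have hBmem : ∀ {u}, u ∈ B ↔ u ≠ w ∧ ¬ G.Adj w u := by simp [hB, nonNeighbors]
  have hsum : ∀ f : V → ℝ, ∑ u, f u = f w + ∑ u ∈ A, f u + ∑ u ∈ B, f u :=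
    sum_eq_add_sum_neighbors w
  have hAy : ∑ u ∈ A, y u = ν := by
    have := hev w
    rwa [hw, mul_one, ← Finset.sum_filter, ← SimpleGraph.neighborFinset_eq_filter] at this
  have hcw : (adj (cone w (link G w)) *ᵥ t) w = ν + B.card / ν := by
    rw [adj_mulVec_apply, hsum]
    have e1 : ∀ u ∈ A, (if (cone w (link G w)).Adj w u then t u else 0) = y u := fun u hu => by
      rw [if_pos ⟨(hAmem.1 hu).ne, Or.inl rfl⟩, htA u hu]
    have e2 : ∀ u ∈ B, (if (cone w (link G w)).Adj w u then t u else 0) = 1 / ν := fun u hu => by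
      rw [if_pos ⟨(hBmem.1 hu).1.symm, Or.inl rfl⟩, htB u hu]
    rw [Finset.sum_congr rfl e1, Finset.sum_congr rfl e2, hAy]
    simp [div_eq_mul_inv]
  have hcB : ∀ u ∈ B, (adj (cone w (link G w)) *ᵥ t) u = 1 := by
    intro u hu
    rw [adj_mulVec_apply, Finset.sum_eq_single w]
    · rw [if_pos ⟨(hBmem.1 hu).1, Or.inr (Or.inl rfl)⟩, htw]
    · intro v _ hv
      refine if_neg ?_
      rintro ⟨-, h | h | h⟩
      exacts [(hBmem.1 hu).1 h, hv h, (hBmem.1 hu).2 h.2.1]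
    · simp
  have hcA : ∀ u ∈ A, (adj (cone w (link G w)) *ᵥ t) u =
      ν * y u - ∑ v ∈ B, if G.Adj u v then y v else 0 := by
    intro u hu
    have hwu := hAmem.1 hu
    rw [adj_mulVec_apply, hsum, ← hev u, hsum fun v => if G.Adj u v then y v else 0]
    have e1 : ∀ v ∈ A, (if (cone w (link G w)).Adj u v then t v else 0) =
        if G.Adj u v then y v else 0 := fun v hv => by
      have hwv := hAmem.1 hv
      by_cases h : G.Adj u v
      · rw [if_pos ⟨h.ne, Or.inr (Or.inr ⟨h, hwu, hwv⟩)⟩, if_pos h, htA v hv]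
      · rw [if_neg h, if_neg]
        rintro ⟨-, h' | h' | h'⟩
        exacts [hwu.ne' h', hwv.ne' h', h h'.1]
    have e2 : ∀ v ∈ B, (if (cone w (link G w)).Adj u v then t v else 0) = 0 := fun v hv => by
      refine if_neg ?_
      rintro ⟨-, h' | h' | h'⟩
      exacts [hwu.ne' h', (hBmem.1 hv).1 h', (hBmem.1 hv).2 h'.2.2]
    rw [Finset.sum_congr rfl e1, Finset.sum_congr rfl e2,
      if_pos ⟨hwu.ne', Or.inr (Or.inl rfl)⟩, if_pos hwu.symm, htw, hw]
    simp
  have hcross : crossWeight G w y = ∑ u ∈ A, y u * ∑ v ∈ B, if G.Adj u v then y v else 0 := by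
    refine Finset.sum_congr rfl fun u _ => ?_
    rw [Finset.mul_sum]
    exact Finset.sum_congr rfl fun v _ => by split_ifs <;> simp
  have hq : t ⬝ᵥ adj (cone w (link G w)) *ᵥ t = (ν + B.card / ν) +
      (ν * ∑ u ∈ A, y u * y u - crossWeight G w y) + B.card * (1 / ν) := by
    rw [dotProduct, hsum, htw, hcw, hcross, Finset.mul_sum, ← Finset.sum_sub_distrib]
    congr 1
    · congr 1
      · ring
      · refine Finset.sum_congr rfl fun u hu => ?_
        rw [htA u hu, hcA u hu]; ring
    · rw [Finset.sum_congr rfl fun u hu => by rw [htB u hu, hcB u hu, mul_one]]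
      simp
  have hn : t ⬝ᵥ t = 1 + ∑ u ∈ A, y u * y u + B.card * (1 / ν * (1 / ν)) := by
    rw [dotProduct, hsum, htw]
    have e1 : ∀ u ∈ A, t u * t u = y u * y u := fun u hu => by rw [htA u hu]
    have e2 : ∀ u ∈ B, t u * t u = 1 / ν * (1 / ν) := fun u hu => by rw [htB u hu]
    rw [Finset.sum_congr rfl e1, Finset.sum_congr rfl e2]
    simp
  rw [hq, hn]
  field_simp
  ring

/-- Each non-neighbour shares at most two neighbours with `w`, and each such edge weighs at most
`δ²`. -/
theorem IsOuterplanar.abs_crossWeight_le (hG : IsOuterplanar G) {w : V} {y : V → ℝ} {δ : ℝ}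
    (hδ : ∀ u, u ≠ w → |y u| ≤ δ) :
    |crossWeight G w y| ≤ 2 * δ ^ 2 * (nonNeighbors G w).card := by
  rw [crossWeight, Finset.sum_comm]
  refine (Finset.abs_sum_le_sum_abs _ _).trans ?_
  have h : ∀ v ∈ nonNeighbors G w,
      |∑ u ∈ G.neighborFinset w, if G.Adj u v then y u * y v else 0| ≤ 2 * δ ^ 2 := by
    intro v hv
    simp only [nonNeighbors, Finset.mem_filter, Finset.mem_univ, true_and] at hv
    refine (Finset.abs_sum_le_sum_abs _ _).trans ?_
    have hδ0 : 0 ≤ δ := (abs_nonneg _).trans (hδ v hv.1)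
    have h1 : ∀ u ∈ G.neighborFinset w, |if G.Adj u v then y u * y v else 0| ≤
        if G.Adj u v then δ ^ 2 else 0 := by
      intro u hu
      have huw : u ≠ w := SimpleGraph.Adj.ne' (by simpa using hu)
      split_ifs
      · rw [abs_mul, sq]
        exact mul_le_mul (hδ u huw) (hδ v hv.1) (abs_nonneg _) hδ0
      · simp
    refine (Finset.sum_le_sum h1).trans ?_
    rw [← Finset.sum_filter, Finset.sum_const, nsmul_eq_mul]
    refine mul_le_mul_of_nonneg_right ?_ (sq_nonneg _)
    have : (G.neighborFinset w).filter (fun u => G.Adj u v) =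
        Finset.univ.filter fun x => G.Adj w x ∧ G.Adj v x := by
      ext x; simp [G.adj_comm]
    rw [this]
    exact_mod_cast hG.card_common_le hv.1.symm
  refine (Finset.sum_le_sum h).trans ?_
  rw [Finset.sum_const, nsmul_eq_mul, mul_comm]

end Cone

end OuterplanarSpread

/-! ### Extremal graphs -/

namespace OuterplanarSpread

section Extremal

variable {V : Type*} [Fintype V] [DecidableEq V] {G : SimpleGraph V}

/-- Both roots `ρ = ±√(n - 1)` are allowed, so this covers both ends of the spectrum of the star. -/
theorem adj_star_mulVec (w : V) {ρ : ℝ} (hρ : ρ ^ 2 = Fintype.card V - 1) :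
    adj (cone w ⊥) *ᵥ (fun u => if u = w then ρ else 1) = ρ • fun u => if u = w then ρ else 1 := by
  classical
  ext u
  rw [adj_mulVec_apply, Pi.smul_apply, smul_eq_mul]
  by_cases hu : u = w
  · subst hu
    have h : ∀ v, (if (cone u (⊥ : SimpleGraph V)).Adj u v then (if v = u then ρ else 1) else 0) =
        1 - if v = u then (1 : ℝ) else 0 := by
      intro v
      by_cases hv : v = u
      · subst hv; simp
      · simp [cone, hv, Ne.symm hv]
    rw [Finset.sum_congr rfl fun v _ => h v, Finset.sum_sub_distrib]
    simp [← hρ, sq]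
  · rw [Finset.sum_eq_single w]
    · simp [cone, hu]
    · intro v _ hv
      simp [cone, hu, hv]
    · simp

theorem IsSpreadExtremal.two_mul_le_spread [Nonempty V] (hG : IsSpreadExtremal G) {r : ℝ}
    (hr : r ^ 2 = Fintype.card V - 1) (hr0 : r ≠ 0) : 2 * r ≤ spread G := by
  obtain ⟨w⟩ := ‹Nonempty V›
  refine le_trans ?_ (hG.2 _ (hG.1.cone_bot w))
  have hne : ∀ ρ : ℝ, ρ ≠ 0 → (fun u => if u = w then ρ else (1 : ℝ)) ≠ 0 := fun ρ hρ h => hρ (by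
    simpa using congr_fun h w)
  have := sub_le_spread (a := r) (b := -r) (hne r hr0) (hne (-r) (neg_ne_zero.2 hr0))
    (by rw [adj_star_mulVec w hr, dotProduct_smul, smul_eq_mul])
    (by rw [adj_star_mulVec w (ρ := -r) (by simpa using hr), dotProduct_smul, smul_eq_mul])
  linarith

theorem mulVec_inv_smul {V : Type*} [Fintype V] {A : Matrix V V ℝ} {x : V → ℝ} {ν : ℝ} (h : A *ᵥ x = ν • x) (c : ℝ) :
    A *ᵥ (c⁻¹ • x) = ν • c⁻¹ • x := by
  rw [Matrix.mulVec_smul, h, smul_comm]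

theorem IsPerronVector.exists_normalized {x : V → ℝ} (hx : IsPerronVector G x) {w : V}
    (hw : ∀ u, x u ≤ x w) : ∃ (M : ℝ) (y : V → ℝ), IsGreatest (spectrum ℝ (adj G)) M ∧
      adj G *ᵥ y = M • y ∧ (∀ u, |y u| ≤ 1) ∧ y w = 1 := by
  obtain ⟨M, hM, hx0, hxn, hxM⟩ := hx
  have hpos : 0 < x w := by
    by_contra! hle
    exact hx0 (funext fun u => le_antisymm ((hw u).trans hle) (hxn u))
  refine ⟨M, (x w)⁻¹ • x, hM, mulVec_inv_smul hxM _, fun u => ?_, ?_⟩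
  · rw [Pi.smul_apply, smul_eq_mul, abs_of_nonneg (mul_nonneg (inv_nonneg.2 hpos.le) (hxn u)),
      inv_mul_le_one₀ hpos]
    exact hw u
  · simp [hpos.ne']

theorem IsLeastEigenvector.exists_normalized {z : V → ℝ} (hz : IsLeastEigenvector G z) {w : V}
    (hw : ∀ u, |z u| ≤ |z w|) : ∃ (m : ℝ) (y : V → ℝ), IsLeast (spectrum ℝ (adj G)) m ∧
      adj G *ᵥ y = m • y ∧ (∀ u, |y u| ≤ 1) ∧ y w = 1 := by
  obtain ⟨m, hm, hz0, hzm⟩ := hz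
  have hpos : 0 < |z w| := by
    by_contra! hle
    exact hz0 (funext fun u => abs_nonpos_iff.1 ((hw u).trans hle))
  refine ⟨m, (z w)⁻¹ • z, hm, mulVec_inv_smul hzm _, fun u => ?_, ?_⟩
  · rw [Pi.smul_apply, smul_eq_mul, abs_mul, abs_inv, inv_mul_le_one₀ hpos]
    exact hw u
  · simp [abs_pos.1 hpos]

/-- In a large extremal outerplanar graph, the maximum entries of the extreme eigenvectors are
attained at the same vertex, and this vertex is adjacent to all others. -/
theorem IsSpreadExtremal.eq_and_degree_eq [DecidableRel G.Adj] (hG : IsSpreadExtremal G)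
    (hcard : 1000001 ≤ Fintype.card V) {x z : V → ℝ} (hx : IsPerronVector G x)
    (hz : IsLeastEigenvector G z) {w w' : V} (hw : ∀ u, x u ≤ x w)
    (hw' : ∀ u, |z u| ≤ |z w'|) : w' = w ∧ G.degree w + 1 = Fintype.card V := by
  have hne : Nonempty V := ⟨w⟩
  obtain ⟨M, y, hM, hyM, hy1, hyw⟩ := hx.exists_normalized hw
  obtain ⟨m, t, hm, htm, ht1, htw⟩ := hz.exists_normalized hw'
  have hout := hG.1
  set n : ℝ := (Fintype.card V : ℝ) with hn
  have hn1 : (1000001 : ℝ) ≤ n := by rw [hn]; exact_mod_cast hcard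
  -- The threshold `1000001` is `1000² + 1`; `r ≥ 1000` suffices for all the numerical estimates
  -- below.
  obtain ⟨r, hr1000, hr⟩ : ∃ r : ℝ, 1000 ≤ r ∧ r ^ 2 = n - 1 := by
    refine ⟨√(n - 1), Real.le_sqrt_of_sq_le (by linarith), Real.sq_sqrt (by linarith)⟩
  have hr0 : 0 < r := by linarith
  have hspread := spread_eq hM hm
  have h2r : 2 * r ≤ M - m := hspread ▸ hG.two_mul_le_spread hr hr0.ne'
  have hmM := neg_least_le_greatest hM hm
  have hMr : r ≤ M := by linarith
  have hM0 : 0 < M := by linarith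
  have hn' : n = r ^ 2 + 1 := by linarith
  have hrr : 1000 * r ≤ r ^ 2 := by
    rw [sq]; exact mul_le_mul_of_nonneg_right hr1000 hr0.le
  have hdeg_le : ∀ u, (G.degree u : ℝ) ≤ r ^ 2 := fun u => by
    have : (G.degree u : ℝ) + 1 ≤ n := by rw [hn]; exact_mod_cast G.degree_lt_card_verts u
    linarith
  -- The error term `12n/|M|` is about `12r`; raising it to `13r` absorbs the lower-order terms.
  have hdivM : 12 * n / |M| ≤ 13 * r := by
    rw [abs_of_pos hM0, div_le_iff₀ hM0]
    have := mul_le_mul_of_nonneg_left hMr hr0.le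
    linarith
  have hM2 : M ^ 2 ≤ G.degree w + 13 * r := by
    have := hout.sq_mul_abs_le_add_div hyM hy1 hM0.ne' w
    rw [hyw, abs_one, mul_one, mul_one] at this
    linarith
  -- Since `(r + 7)² > r² + 13r`. With `M + μ ≥ 2r` this also forces `μ ≥ r - 7`.
  have hM7 : M ≤ r + 7 := by
    by_contra! hlt
    have h1 := pow_lt_pow_left₀ hlt (by linarith) two_ne_zero
    have h2 := hdeg_le w
    linarith
  have hdw : r ^ 2 - 13 * r ≤ G.degree w := by
    have := pow_le_pow_left₀ hr0.le hMr 2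
    linarith
  obtain ⟨μ, rfl⟩ : ∃ μ, m = -μ := ⟨-m, by ring⟩
  have hμr : r - 7 ≤ μ := by linarith
  have hμM : μ ≤ r + 7 := by linarith
  have hμ0 : 0 < μ := by linarith
  have hdivμ : 12 * n / |(-μ)| ≤ 13 * r := by
    rw [abs_neg, abs_of_pos hμ0, div_le_iff₀ hμ0]
    have := mul_le_mul_of_nonneg_left hμr hr0.le
    linarith
  have hμ2 : μ ^ 2 ≤ G.degree w' + 13 * r := by
    have := hout.sq_mul_abs_le_add_div htm ht1 (neg_ne_zero.2 hμ0.ne') w'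
    rw [htw, abs_one, mul_one, mul_one, neg_sq] at this
    linarith
  have hμsq : (r - 7) ^ 2 ≤ μ ^ 2 := pow_le_pow_left₀ (by linarith) hμr 2
  have hdw' : r ^ 2 - 27 * r ≤ G.degree w' := by linarith
  -- Two different vertices of degree at least `r² - 27r` would exceed the total `n + 2`.
  have hww : w' = w := by
    by_contra hcon
    have h1 := hout.degree_add_degree_le hcon
    have h2 : (G.degree w' : ℝ) + G.degree w ≤ n + 2 := by rw [hn]; exact_mod_cast h1
    linarith
  subst hww
  refine ⟨rfl, ?_⟩
  have hdsmall : ∀ u, u ≠ w' → (G.degree u : ℝ) ≤ 14 * r := fun u hu => by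
    have h1 := hout.degree_add_degree_le hu
    have h2 : (G.degree u : ℝ) + G.degree w' ≤ n + 2 := by rw [hn]; exact_mod_cast h1
    linarith
  have hsmall : ∀ (ν : ℝ) (v : V → ℝ), adj G *ᵥ v = ν • v → (∀ u, |v u| ≤ 1) → ν ≠ 0 →
      12 * n / |ν| ≤ 13 * r → (r - 7) ^ 2 ≤ ν ^ 2 → ∀ u, u ≠ w' → |v u| ≤ 14 / r := by
    intro ν v hv hv1 hν hdiv hsq u hu
    have h1 := hout.sq_mul_abs_le_add_div hv hv1 hν u
    have h2 : (G.degree u : ℝ) * |v u| ≤ 14 * r * |v u| :=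
      mul_le_mul_of_nonneg_right (hdsmall u hu) (abs_nonneg _)
    have h3 : (r - 7) ^ 2 * |v u| ≤ ν ^ 2 * |v u| :=
      mul_le_mul_of_nonneg_right hsq (abs_nonneg _)
    -- Here `(r - 7)² - 14r ≥ r * (r - 28)`.
    have h4 : r * ((r - 28) * |v u|) ≤ r * 13 := by linarith [abs_nonneg (v u)]
    have h5 : (r - 28) * |v u| ≤ 13 := le_of_mul_le_mul_left h4 hr0
    have h6 : 972 * |v u| ≤ (r - 28) * |v u| :=
      mul_le_mul_of_nonneg_right (by linarith) (abs_nonneg _)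
    rw [le_div_iff₀ hr0]
    linarith
  have hys := hsmall M y hyM hy1 hM0.ne' hdivM
    (pow_le_pow_left₀ (by linarith) (by linarith) 2)
  have hts := hsmall (-μ) t htm ht1 (neg_ne_zero.2 hμ0.ne') hdivμ
    (by rwa [neg_sq])
  by_contra hdeg
  have hBpos : 0 < (nonNeighbors G w').card := by
    have := card_nonNeighbors (G := G) w'
    omega
  set b : ℝ := ((nonNeighbors G w').card : ℝ) with hb
  have hb0 : 0 < b := by rw [hb]; exact_mod_cast hBpos
  -- The lost weight is at most `2 * (14/r)² * b`, below the gain of at least `b / (r + 7)` because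
  -- `392 * (r + 7) < r²`.
  have hcross : ∀ v : V → ℝ, (∀ u, u ≠ w' → |v u| ≤ 14 / r) →
      |crossWeight G w' v| < b / (r + 7) := by
    intro v hv
    refine (hout.abs_crossWeight_le hv).trans_lt ?_
    rw [← hb, lt_div_iff₀ (by linarith), div_pow]
    have : 2 * ((14 : ℝ) ^ 2 / r ^ 2) * (r + 7) < 1 := by
      rw [mul_div_assoc', div_mul_eq_mul_div, div_lt_one (by positivity)]
      linarith
    have := mul_lt_mul_of_pos_left this hb0
    linarith
  have hq : ∀ ν : ℝ, 0 < ν → ν ≤ r + 7 → b / (r + 7) ≤ b / ν := fun ν h0 h7 =>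
    div_le_div_of_nonneg_left hb0.le h0 h7
  have hnz : ∀ (ν : ℝ) (v : V → ℝ), testVector G w' ν v ≠ 0 := fun ν v h => by
    have := congr_fun h w'
    rw [testVector_self] at this
    exact one_ne_zero this
  -- In the cone the quotient of the first test vector exceeds `M` and that of the second is below
  -- `-μ`, contradicting maximality of the spread.
  have hlt := sub_lt_spread (G := cone w' (link G w')) (a := M) (b := -μ)
    (hnz M y) (hnz (-μ) t)
    (by
      rw [rayleigh_testVector hM0.ne' hyM hyw, ← hb]
      have h1 := hcross y hys
      have h2 := hq M hM0 hM7
      have h3 := le_abs_self (crossWeight G w' y)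
      linarith)
    (by
      rw [rayleigh_testVector (neg_ne_zero.2 hμ0.ne') htm htw, ← hb, div_neg]
      have h1 := hcross t hts
      have h2 := hq μ hμ0 hμM
      have h3 := neg_abs_le (crossWeight G w' t)
      linarith)
  have hle := hG.2 _ (hout.cone_link w')
  rw [hspread] at hle
  linarith

end Extremal

/-- A vertex of an outerplanar graph which is adjacent to all others splits the graph as a join of
a single vertex and a linear forest. -/
theorem IsOuterplanar.exists_iso_join {n : ℕ} {G : SimpleGraph (Fin n)} [DecidableRel G.Adj]
    (hG : IsOuterplanar G) {w : Fin n} (hw : G.degree w = n - 1) :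
    ∃ F : SimpleGraph (Fin (n - 1)), IsLinearForest F ∧
      ∃ φ : G ≃g join (⊤ : SimpleGraph (Fin 1)) F, φ w = Sum.inl 0 := by
  cases n with
  | zero => exact w.elim0
  | succ k =>
    have hadj : ∀ u, u ≠ w → G.Adj w u := by
      have h := card_nonNeighbors (G := G) w
      rw [hw, Fintype.card_fin] at h
      have h0 : nonNeighbors G w = ∅ := Finset.card_eq_zero.1 (by omega)
      intro u hu
      by_contra hcon
      have : u ∈ nonNeighbors G w := by simp [nonNeighbors, hu, hcon]
      rw [h0] at this
      simp at this
    let e : Fin k → Fin (k + 1) := w.succAbove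
    have he : Function.Injective e := Fin.succAbove_right_injective
    have hew : ∀ i, G.Adj w (e i) := fun i => hadj _ (Fin.succAbove_ne w i)
    refine ⟨G.comap e, hG.isLinearForest he fun x y h => ⟨h, hew x, hew y⟩, ?_⟩
    let g : Fin 1 ⊕ Fin k → Fin (k + 1) := Sum.elim (fun _ => w) e
    have hg : Function.Bijective g := by
      constructor
      · rintro (a | a) (b | b) h
        · rw [Subsingleton.elim a b]
        · exact absurd h.symm (Fin.succAbove_ne w b)
        · exact absurd h (Fin.succAbove_ne w a)
        · rw [he h]
      · intro u
        by_cases hu : u = w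
        · exact ⟨Sum.inl 0, hu.symm⟩
        · obtain ⟨i, hi⟩ := Fin.exists_succAbove_eq hu
          exact ⟨Sum.inr i, hi⟩
    let ψ : join (⊤ : SimpleGraph (Fin 1)) (G.comap e) ≃g G :=
      { toEquiv := Equiv.ofBijective g hg
        map_rel_iff' := by
          rintro (a | a) (b | b)
          · simp [join, g, Subsingleton.elim a b]
          · simpa [join, g] using hew b
          · simpa [join, g] using (hew a).symm
          · simp [join, g] }
    refine ⟨ψ.symm, ?_⟩
    rw [← ψ.symm_apply_apply (Sum.inl 0)]
    rfl

end OuterplanarSpread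

theorem theorem3 :
    ∃ N : ℕ, ∀ n : ℕ, N ≤ n → ∀ (G : SimpleGraph (Fin n)) [DecidableRel G.Adj],
      OuterplanarSpread.IsSpreadExtremal G →
        (∃ x : Fin n → ℝ, OuterplanarSpread.IsPerronVector G x) ∧
        ∀ x : Fin n → ℝ, OuterplanarSpread.IsPerronVector G x →
          ∀ w : Fin n, (∀ u, x u ≤ x w) →
            G.degree w = n - 1 ∧
            (∃ F : SimpleGraph (Fin (n - 1)), OuterplanarSpread.IsLinearForest F ∧
              ∃ φ : G ≃g OuterplanarSpread.join (⊤ : SimpleGraph (Fin 1)) F, φ w = Sum.inl 0) ∧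
            ∀ z : Fin n → ℝ, OuterplanarSpread.IsLeastEigenvector G z →
              ∀ w' : Fin n, (∀ u, |z u| ≤ |z w'|) → w' = w := by
  refine ⟨1000001, fun n hn G _ hG => ?_⟩
  have hne : Nonempty (Fin n) := ⟨⟨0, by omega⟩⟩
  refine ⟨OuterplanarSpread.exists_isPerronVector, fun x hx w hw => ?_⟩
  have hcard : 1000001 ≤ Fintype.card (Fin n) := by simpa using hn
  -- The degree claim does not involve the least eigenvalue, but its proof does, so some least
  -- eigenvector and a maximizer of its modulus are supplied.
  obtain ⟨z₀, hz₀⟩ := OuterplanarSpread.exists_isLeastEigenvector (G := G)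
  obtain ⟨w₀, hw₀⟩ := Finite.exists_max fun u => |z₀ u|
  have hdeg : G.degree w = n - 1 := by
    have := (hG.eq_and_degree_eq hcard hx hz₀ hw hw₀).2
    rw [Fintype.card_fin] at this
    omega
  exact ⟨hdeg, hG.1.exists_iso_join hdeg, fun z hz w' hw' =>
    (hG.eq_and_degree_eq hcard hx hz hw hw').1⟩
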